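/- A \emph{squares category} $\mathcal C$ consists of a set of objects, two (small) categories $\mathcal M$ (horizontal morphisms) and $\mathcal E$ (vertical morphisms) on this set of objects, an object $O$ that is initial in both $\mathcal M$ and $\mathcal E$, and a collection of \emph{distinguished squares} $$\begin{array}{ccc} A & \xrightarrow{\,f\,} & B\\ {\scriptstyle g}\downarrow & & \downarrow{\scriptstyle g'}\\ C & \xrightarrow{\,f'\,} & D\end{array}\qquad (f,f'\in\mathcal M,\ g,g'\in\mathcal E)$$ that is closed under horizontal and vertical composition and contains, for every $f\in\mathcal M$, the square with $f$ as both horizontal edges and identities as vertical edges and, for every $g\in\mathcal E$, the square with $g$ as both vertical edges and identities as horizontal edges. Let $T_n\mathcal C$ be the category whose objects are the functors $[n]\to\mathcal M$ and whose morphisms $F\to G$ are the families of vertical morphisms $\alpha_i\colon F(i)\to G(i)$ such that for all $i\le j$ the square with edges $F(i\to j)$, $G(i\to j)$, $\alpha_i$, $\alpha_j$ is distinguished. These form a simplicial category $T_\bullet\mathcal C$, whose levelwise nerve is a bisimplicial set $N_\bullet T_\bullet\mathcal C$. Let $|N_\bullet T_\bullet\mathcal C|$ be the geometric realization of its diagonal,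 and let $K_0^\square(\mathcal C)=\pi_0\,\Omega_O|N_\bullet T_\bullet\mathcal C|=\pi_1(|N_\bullet T_\bullet\mathcal C|,O)$. A distinguished square is a $1$-simplex of the diagonal, from its upper left to its lower right corner. \textbf{Theorem.} Let $\mathcal C$ be a squares category such that for all objects $A,B$ there are an object $X$ and distinguished squares $$\begin{array}{ccc} O & \to & A\\ \downarrow & & \downarrow\\ B & \to & X\end{array}\qquad\text{and}\qquad \begin{array}{ccc} O & \to & B\\ \downarrow & & \downarrow\\ A & \to & X.\end{array}$$ Then $K_0^\square(\mathcal C)$ is isomorphic to the quotient of the free abelian group on the objects of $\mathcal C$ by the relations $[O]=0$ and $[A]+[D]=[B]+[C]$ for every distinguished square with upper left corner $A$, upper right corner $B$, lower left corner $C$ and lower right corner $D$. The isomorphism can be chosen so that $[A]$ corresponds, for every object $A$, to the class of the loop that runs from $O$ to $A$ along the $1$-simplex of the vertical morphism $O\to A$ and returns to $O$ along the $1$-simplex of the horizontal morphism $O\to A$. -/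

import Mathlib

universe u

section

open CategoryTheory Opposite Simplicial

/-- A simple double category: a small double category whose 2-cells are determined by their
boundaries. `catM` is the category of horizontal morphisms and `catE` the category of vertical
morphisms, on the same set of objects. `Dist f f' g g'` says that the square with top edge `f`,
bottom edge `f'`, left edge `g` and right edge `g'` is distinguished. -/
structure SimpleDoubleCategory where
  Ob : Type u
  catM : Category.{u} Ob
  catE : Category.{u} Ob
  Dist : ∀ {A B C D : Ob}, catM.Hom A B → catM.Hom C D → catE.Hom A C → catE.Hom B D → Prop
  dist_vcomp : ∀ {A B C D E F : Ob} {f : catM.Hom A B} {f' : catM.Hom C D} {f'' : catM.Hom E F}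
    {g : catE.Hom A C} {g' : catE.Hom B D} {h : catE.Hom C E} {h' : catE.Hom D F},
    Dist f f' g g' → Dist f' f'' h h' → Dist f f'' (catE.comp g h) (catE.comp g' h')
  dist_hcomp : ∀ {A B C D E F : Ob} {f : catM.Hom A B} {k : catM.Hom B C} {f' : catM.Hom D E}
    {k' : catM.Hom E F} {g : catE.Hom A D} {g' : catE.Hom B E} {g'' : catE.Hom C F},
    Dist f f' g g' → Dist k k' g' g'' → Dist (catM.comp f k) (catM.comp f' k') g g''
  dist_vid : ∀ {A B : Ob} (f : catM.Hom A B), Dist f f (catE.id A) (catE.id B)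
  dist_hid : ∀ {A B : Ob} (g : catE.Hom A B), Dist (catM.id A) (catM.id B) g g

/-- A squares category: a simple double category with a chosen object `O` which is initial both
for the horizontal and for the vertical morphisms. -/
structure SquaresCategory extends SimpleDoubleCategory.{u} where
  O : Ob
  isInitialM : @Limits.IsInitial Ob catM O
  isInitialE : @Limits.IsInitial Ob catE O

namespace SimpleDoubleCategory

variable (C : SimpleDoubleCategory.{u})

/-- The objects of `C`, regarded as the objects of the category of horizontal morphisms. -/
def M : Type u := C.Ob

/-- The objects of `C`, regarded as the objects of the category of vertical morphisms. -/
def E : Type u := C.Ob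

instance : Category.{u} C.M := C.catM

instance : Category.{u} C.E := C.catE

/-- A horizontal functor `D → C`: a functor from `D` to the horizontal morphisms of `C`. -/
structure HFun (D : Type) [Category.{0} D] where
  functor : D ⥤ C.M

variable {C}

namespace HFun

variable {D D' : Type} [Category.{0} D] [Category.{0} D']

/-- A vertical distinguished transformation between horizontal functors. -/
@[ext]
structure Hom (F G : C.HFun D) where
  app : ∀ X : D, C.catE.Hom (F.functor.obj X) (G.functor.obj X)
  dist : ∀ {X Y : D} (f : X ⟶ Y), C.Dist (F.functor.map f) (G.functor.map f) (app X) (app Y)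

/-- The category of horizontal functors and vertical distinguished transformations. -/
instance : Category.{u} (C.HFun D) where
  Hom F G := Hom F G
  id F := ⟨fun X => C.catE.id (F.functor.obj X), fun f => C.dist_vid (F.functor.map f)⟩
  comp α β := ⟨fun X => C.catE.comp (α.app X) (β.app X), fun f => C.dist_vcomp (α.dist f) (β.dist f)⟩
  id_comp α := Hom.ext (funext fun X => C.catE.id_comp (α.app X))
  comp_id α := Hom.ext (funext fun X => C.catE.comp_id (α.app X))
  assoc α β γ := Hom.ext (funext fun X => C.catE.assoc (α.app X) (β.app X) (γ.app X))

/-- Precomposition of horizontal functors with an ordinary functor. -/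
def precomp (C : SimpleDoubleCategory.{u}) (P : D ⥤ D') : C.HFun D' ⥤ C.HFun D where
  obj F := ⟨P ⋙ F.functor⟩
  map α := ⟨fun X => α.app (P.obj X), fun f => α.dist (P.map f)⟩
  map_id _ := rfl
  map_comp _ _ := rfl

end HFun

variable (C)

/-- The simplicial category `T_• C`, with `T_n C` the category of horizontal functors `[n] → C`.
The simplicial operators are given by precomposition. -/
def T : SimplicialObject Cat.{u, u} where
  obj n := Cat.of (C.HFun (Fin (n.unop.len + 1)))
  map f := (HFun.precomp C (SimplexCategory.toCat.map f.unop).toFunctor).toCatHom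
  map_id _ := rfl
  map_comp _ _ := rfl

/-- The bisimplicial set `N_• T_• C`: the first variable is the simplicial direction of `T_• C`
and the second one is the direction of the nerve. -/
def NT : SimplicialObject SSet.{u} := C.T ⋙ nerveFunctor.{u, u}

/-- The diagonal simplicial set of `N_• T_• C`. -/
def diagNT : SSet.{u} :=
  Functor.diag SimplexCategoryᵒᵖ ⋙ Functor.uncurry.obj C.NT

/-- The geometric realization `|N_• T_• C|` of the bisimplicial set `N_• T_• C`, that is, the
geometric realization of its diagonal. -/
noncomputable def realization : TopCat.{u} := SSet.toTop.obj C.diagNT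

variable {C}

/-- An object of `C` as a horizontal functor `[0] → C`. -/
def hFun₀ (A : C.Ob) : C.HFun (Fin 1) := ⟨ComposableArrows.mk₀ (C := C.M) A⟩

/-- A horizontal morphism of `C` as a horizontal functor `[1] → C`. -/
def hFun₁ {A B : C.Ob} (f : C.catM.Hom A B) : C.HFun (Fin 2) :=
  ⟨ComposableArrows.mk₁ (C := C.M) f⟩

/-- A distinguished square as a morphism of `T_1 C`. -/
def squareHom {A B A' B' : C.Ob} {f : C.catM.Hom A B} {f' : C.catM.Hom A' B'}
    {g : C.catE.Hom A A'} {g' : C.catE.Hom B B'} (h : C.Dist f f' g g') :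
    hFun₁ f ⟶ hFun₁ f' where
  app X := match X with
    | 0 => g
    | 1 => g'
  dist := by
    intro X Y k
    match X, Y, k with
    | 0, 0, _ => exact C.dist_hid g
    | 0, 1, _ => exact h
    | 1, 1, _ => exact C.dist_hid g'
    | 1, 0, k => exact absurd (leOfHom k) (by decide)

/-- An object of `C` as a vertex of the diagonal of `N_• T_• C`. -/
def vertex (A : C.Ob) : C.diagNT _⦋0⦌ := ComposableArrows.mk₀ (hFun₀ A)

/-- A distinguished square as a 1-simplex of the diagonal of `N_• T_• C`. -/
def square {A B A' B' : C.Ob} {f : C.catM.Hom A B} {f' : C.catM.Hom A' B'}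
    {g : C.catE.Hom A A'} {g' : C.catE.Hom B B'} (h : C.Dist f f' g g') : C.diagNT _⦋1⦌ :=
  ComposableArrows.mk₁ (squareHom h)

lemma HFun.ext_functor {D : Type} [Category.{0} D] {F G : C.HFun D}
    (h : F.functor = G.functor) : F = G := by
  cases F; cases G; cases h; rfl

/-- A distinguished square as an edge from its upper left corner to its lower right corner. -/
def squareEdge {A B A' B' : C.Ob} {f : C.catM.Hom A B} {f' : C.catM.Hom A' B'}
    {g : C.catE.Hom A A'} {g' : C.catE.Hom B B'} (h : C.Dist f f' g g') :
    SSet.Edge (X := C.diagNT) (vertex A) (vertex B') :=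
  SSet.Edge.mk (square h)
    (ComposableArrows.ext₀ (HFun.ext_functor (ComposableArrows.ext₀ rfl)))
    (ComposableArrows.ext₀ (HFun.ext_functor (ComposableArrows.ext₀ rfl)))

end SimpleDoubleCategory

/-- The point of the geometric realization given by a vertex. -/
noncomputable def SSet.realizationPoint {X : SSet.{u}} (x : X _⦋0⦌) : SSet.toTop.obj X :=
  TopCat.toSSetObj₀Equiv ((sSetTopAdj.unit.app X).app _ x)

lemma SSet.realizationPath_aux {X : SSet.{u}} (s : X _⦋1⦌) (i : Fin 2) (t : unitInterval)
    (hi : stdSimplexHomeomorphUnitInterval (_root_.stdSimplex.vertex (S := ℝ) (i.succAbove 0)) = t)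
    {x : X _⦋0⦌} (hx : X.δ i s = x) :
    TopCat.toSSetObjEquiv _ _ ((sSetTopAdj.unit.app X).app (op ⦋1⦌) s)
      (stdSimplexHomeomorphUnitInterval.symm t) = SSet.realizationPoint x := by
  subst hx
  have h := SSet.δ_naturality_apply (sSetTopAdj.unit.app X) i s
  rw [← hi, Homeomorph.symm_apply_apply, ← _root_.stdSimplex.map_vertex (S := ℝ) i.succAbove 0]
  refine (TopCat.toSSetObjEquiv_δ_apply _ i _).symm.trans ?_
  refine Eq.trans ?_ (congrArg TopCat.toSSetObj₀Equiv h).symm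
  rw [TopCat.toSSetObj₀Equiv_apply]
  exact congrArg _ (Subsingleton.elim _ _)

/-- The characteristic map of a 1-simplex of `X`, as a path in the geometric realization. -/
noncomputable def SSet.Edge.realizationPath {X : SSet.{u}} {x y : X _⦋0⦌} (e : SSet.Edge x y) :
    _root_.Path (SSet.realizationPoint x) (SSet.realizationPoint y) where
  toFun t := TopCat.toSSetObjEquiv _ _ ((sSetTopAdj.unit.app X).app _ e.edge)
    (stdSimplexHomeomorphUnitInterval.symm t)
  continuous_toFun := (ContinuousMap.continuous _).comp
    stdSimplexHomeomorphUnitInterval.symm.continuous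
  source' := SSet.realizationPath_aux e.edge 1 0 rfl e.src_eq
  target' := SSet.realizationPath_aux e.edge 0 1 rfl e.tgt_eq

namespace SquaresCategory

variable (C : SquaresCategory.{u})

/-- The basepoint of `|N_• T_• C|` given by the object `O`. -/
noncomputable def basepoint : C.realization :=
  SSet.realizationPoint (SimpleDoubleCategory.vertex C.O)

/-- `K_0(C)`, the fundamental group of `|N_• T_• C|` at `O`, equivalently the set of components
of the loop space `Ω_O |N_• T_• C|`. -/
abbrev K₀ : Type u := FundamentalGroup C.realization C.basepoint

/-- The path from `O` to `A` in `|N_• T_• C|` along the vertical morphism `O → A`. -/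
noncomputable def pathE (A : C.Ob) :
    Path C.basepoint (SSet.realizationPoint (SimpleDoubleCategory.vertex A)) :=
  (SimpleDoubleCategory.squareEdge
    (C.dist_hid (@Limits.IsInitial.to _ C.catE _ C.isInitialE A))).realizationPath

/-- The path from `O` to `A` in `|N_• T_• C|` along the horizontal morphism `O → A`. -/
noncomputable def pathM (A : C.Ob) :
    Path C.basepoint (SSet.realizationPoint (SimpleDoubleCategory.vertex A)) :=
  (SimpleDoubleCategory.squareEdge
    (C.dist_vid (@Limits.IsInitial.to _ C.catM _ C.isInitialM A))).realizationPath

/-- The class in `K_0(C)` of an object `A`: the loop that goes from `O` to `A` along the vertical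
morphism `O → A` and comes back along the horizontal morphism `O → A`. -/
noncomputable def objClass (A : C.Ob) : C.K₀ :=
  FundamentalGroup.fromPath (Path.Homotopic.Quotient.mk ((C.pathE A).trans (C.pathM A).symm))

/-- There is a distinguished square with the given corners
(upper left, upper right, lower left, lower right). -/
def HasSquare (A B A' B' : C.Ob) : Prop :=
  ∃ (f : C.catM.Hom A B) (f' : C.catM.Hom A' B') (g : C.catE.Hom A A') (g' : C.catE.Hom B B'),
    C.Dist f f' g g'

/-- The subgroup of the free abelian group on the objects generated by `[O]` and by
`[A] + [D] - ([B] + [C])` for all distinguished squares. -/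
def relations : AddSubgroup (FreeAbelianGroup C.Ob) :=
  AddSubgroup.closure
    ({FreeAbelianGroup.of C.O} ∪
      {x | ∃ A B A' B' : C.Ob, C.HasSquare A B A' B' ∧
        x = (FreeAbelianGroup.of A + FreeAbelianGroup.of B') -
          (FreeAbelianGroup.of B + FreeAbelianGroup.of A')})

end SquaresCategory

end

/-!
Every path in a geometric realization between two vertices is homotopic to a concatenation of
edges and their inverses. An edge of the diagonal is a distinguished square, and the square with
corners `A`, `B`, `A'`, `B'` is homotopic both to `A → A' → B'` and to `A → B → B'`. Closing paths
up along the vertical morphisms out of `O` therefore kills every vertical morphism, turns a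
horizontal morphism `A → B` into `[B]⁻¹ [A]`, and gives the relation `[B']⁻¹ [A'] = [B]⁻¹ [A]`.
Hence the classes `[A]` generate `K_0`, and its abelianization is a quotient of the presented
group.

For the inverse homomorphism, the rule sending a square to `[A] - [B]` is a 1-cocycle on the
diagonal with values in the presented group. A 1-cocycle with values in `G` defines a map from the
realization to the base of a `G`-covering, whose monodromy extends the cocycle from edges to all
paths. The covering space used here consists of step functions on `[0, 1)` with values in `G`: a
point of a simplex with values of a primitive at the vertices becomes a step function whose steps
have the barycentric coordinates as lengths, and this is compatible with faces and degeneracies on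
the nose.

Finally, if `O, A, B, X` and `O, B, A, X` are corners of distinguished squares, then `[X]` equals
both `[A] [B]` and `[B] [A]`, so that `K_0` is its own abelianization.
-/

section

open CategoryTheory Opposite Simplicial unitInterval

/-- The topological `n`-simplex, with barycentric coordinates indexed by `Fin (n + 1)`. -/
abbrev TopSimplex (n : ℕ) : Type := stdSimplex ℝ (Fin (n + 1))

namespace TopSimplex

variable {l m n : ℕ}

/-- The affine map between topological simplices induced by a morphism of `SimplexCategory`. -/
noncomputable def map (f : ⦋m⦌ ⟶ ⦋n⦌) : C(TopSimplex m, TopSimplex n) :=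
  ⟨stdSimplex.map f, stdSimplex.continuous_map _⟩

lemma map_comp_apply (f : ⦋l⦌ ⟶ ⦋m⦌) (g : ⦋m⦌ ⟶ ⦋n⦌) (a : TopSimplex l) :
    map (f ≫ g) a = map g (map f a) :=
  (stdSimplex.map_comp_apply (f : Fin (l + 1) → Fin (m + 1)) g a).symm

lemma map_id_apply (a : TopSimplex n) : map (𝟙 ⦋n⦌) a = a :=
  stdSimplex.map_id_apply a

lemma map_vertex (f : ⦋m⦌ ⟶ ⦋n⦌) (i : Fin (m + 1)) :
    map f (stdSimplex.vertex i) = stdSimplex.vertex (f i) :=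
  stdSimplex.map_vertex (S := ℝ) (f : Fin (m + 1) → Fin (n + 1)) i

lemma map_apply (f : ⦋m⦌ ⟶ ⦋n⦌) (a : TopSimplex m) (j : Fin (n + 1)) :
    map f a j = ∑ i with f i = j, a i :=
  FunOnFinite.linearMap_apply_apply ℝ ℝ (f : Fin (m + 1) → Fin (n + 1)) a j

lemma map_apply_of_mono (f : ⦋m⦌ ⟶ ⦋n⦌) [Mono f] (a : TopSimplex m) (i : Fin (m + 1)) :
    map f a (f i) = a i := by
  have hf : Function.Injective f := SimplexCategory.mono_iff_injective.1 inferInstance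
  rw [map_apply, Finset.sum_eq_single i]
  · exact fun j hj hne => absurd (hf (by simpa using hj)) hne
  · simp

lemma map_injective_of_mono (f : ⦋m⦌ ⟶ ⦋n⦌) [Mono f] : Function.Injective (map f) := by
  intro a b h
  ext i
  rw [← map_apply_of_mono f a, ← map_apply_of_mono f b, h]

/-- The set of vertices of the carrier of a point, that is, of the smallest face containing it. -/
noncomputable def support (a : TopSimplex n) : Finset (Fin (n + 1)) := {i | 0 < a i}

/-- A point is interior if it lies on no proper face. -/
def IsInterior (a : TopSimplex n) : Prop := ∀ i, 0 < a i

lemma mem_support {a : TopSimplex n} {i : Fin (n + 1)} : i ∈ a.support ↔ 0 < a i := by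
  simp [support]

lemma apply_eq_zero_of_notMem_support {a : TopSimplex n} {i : Fin (n + 1)} (hi : i ∉ a.support) :
    a i = 0 :=
  le_antisymm (not_lt.1 (mem_support.not.1 hi)) (stdSimplex.zero_le a i)

lemma isInterior_iff_support_eq_univ {a : TopSimplex n} :
    a.IsInterior ↔ a.support = Finset.univ := by
  simp [IsInterior, Finset.eq_univ_iff_forall, mem_support]

lemma support_map (f : ⦋m⦌ ⟶ ⦋n⦌) (a : TopSimplex m) : (map f a).support = a.support.image f := by
  ext j
  rw [mem_support, map_apply, Finset.sum_pos_iff_of_nonneg fun i _ => stdSimplex.zero_le a i]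
  simp [mem_support, and_comm]

lemma support_nonempty (a : TopSimplex n) : a.support.Nonempty := by
  obtain ⟨i, -, hi⟩ := Finset.exists_lt_of_sum_lt (s := Finset.univ) (f := 0) (g := a)
    (by simp [stdSimplex.sum_eq_one a])
  exact ⟨i, mem_support.2 hi⟩

lemma IsInterior.map_of_epi (f : ⦋m⦌ ⟶ ⦋n⦌) [Epi f] {a : TopSimplex m} (ha : a.IsInterior) :
    (map f a).IsInterior := by
  rw [isInterior_iff_support_eq_univ] at ha ⊢
  rw [support_map, ha, Finset.image_univ_of_surjective]
  exact SimplexCategory.epi_iff_surjective.1 inferInstance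

lemma exists_map_eq_of_support_subset_range (f : ⦋m⦌ ⟶ ⦋n⦌) [Mono f] {a : TopSimplex n}
    (ha : ∀ j ∈ a.support, j ∈ Set.range f) : ∃ b : TopSimplex m, map f b = a := by
  have hf : Function.Injective f := SimplexCategory.mono_iff_injective.1 inferInstance
  have hzero : ∀ j ∉ Set.range f, a j = 0 := fun j hj =>
    apply_eq_zero_of_notMem_support fun h => hj (ha j h)
  have hsum : ∑ i, a (f i) = 1 :=
    (Fintype.sum_of_injective f hf _ a hzero fun _ => rfl).trans (stdSimplex.sum_eq_one a)
  let b : TopSimplex m := ⟨fun i => a (f i), fun i => stdSimplex.zero_le a (f i), hsum⟩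
  refine ⟨b, ?_⟩
  ext j
  by_cases hj : j ∈ Set.range f
  · obtain ⟨i, rfl⟩ := hj
    exact map_apply_of_mono f b i
  · rw [hzero j hj]
    refine apply_eq_zero_of_notMem_support fun h => hj ?_
    obtain ⟨i, -, rfl⟩ := Finset.mem_image.1 (support_map f b ▸ h)
    exact ⟨i, rfl⟩

theorem exists_isInterior_map_eq (a : TopSimplex n) :
    ∃ (k : ℕ) (f : ⦋k⦌ ⟶ ⦋n⦌) (_ : Mono f) (b : TopSimplex k), b.IsInterior ∧ map f b = a := by
  obtain ⟨k, hk⟩ : ∃ k, a.support.card = k + 1 :=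
    Nat.exists_eq_succ_of_ne_zero a.support_nonempty.card_ne_zero
  let e := a.support.orderEmbOfFin hk
  let f : ⦋k⦌ ⟶ ⦋n⦌ := SimplexCategory.Hom.mk ⟨e, e.monotone⟩
  have hf : Mono f := SimplexCategory.mono_iff_injective.2 e.injective
  obtain ⟨b, hb⟩ := exists_map_eq_of_support_subset_range f (a := a) fun j hj =>
    show j ∈ Set.range e by rwa [Finset.range_orderEmbOfFin]
  refine ⟨k, f, hf, b, fun i => ?_, hb⟩
  rw [← map_apply_of_mono f b i, hb]
  exact mem_support.1 (a.support.orderEmbOfFin_mem hk i)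

lemma IsInterior.support_map_eq {f : ⦋m⦌ ⟶ ⦋n⦌} {b : TopSimplex m} (hb : b.IsInterior) :
    (map f b).support = Finset.univ.image f := by
  rw [support_map, isInterior_iff_support_eq_univ.1 hb]

lemma IsInterior.dim_unique {k₁ k₂ : ℕ} {f₁ : ⦋k₁⦌ ⟶ ⦋n⦌} {f₂ : ⦋k₂⦌ ⟶ ⦋n⦌} [Mono f₁] [Mono f₂]
    {b₁ : TopSimplex k₁} {b₂ : TopSimplex k₂} (h₁ : b₁.IsInterior) (h₂ : b₂.IsInterior)
    (h : map f₁ b₁ = map f₂ b₂) : k₁ = k₂ := by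
  have hcard : ∀ {k : ℕ} {f : ⦋k⦌ ⟶ ⦋n⦌} [Mono f] {b : TopSimplex k}, b.IsInterior →
      (map f b).support.card = k + 1 := fun {k f _ b} hb => by
    have hf : Function.Injective f := SimplexCategory.mono_iff_injective.1 inferInstance
    rw [hb.support_map_eq, Finset.card_image_of_injective _ hf, Finset.card_fin]
  exact Nat.succ_injective ((hcard h₁).symm.trans (h ▸ hcard h₂))

lemma IsInterior.face_unique {k : ℕ} {f₁ f₂ : ⦋k⦌ ⟶ ⦋n⦌} [Mono f₁] [Mono f₂] {b₁ b₂ : TopSimplex k}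
    (h₁ : b₁.IsInterior) (h₂ : b₂.IsInterior) (h : map f₁ b₁ = map f₂ b₂) : f₁ = f₂ := by
  have hmono (f : ⦋k⦌ ⟶ ⦋n⦌) [Mono f] : StrictMono f :=
    f.toOrderHom.monotone.strictMono_of_injective (SimplexCategory.mono_iff_injective.1 ‹_›)
  have himage : Finset.univ.image f₁ = Finset.univ.image f₂ := by
    rw [← h₁.support_map_eq, ← h₂.support_map_eq, h]
  have hrange : Set.range f₁ = Set.range f₂ := by
    simpa using congrArg (fun s : Finset (Fin (n + 1)) => (s : Set (Fin (n + 1)))) himage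
  ext i : 3
  exact congrFun ((StrictMono.range_inj (hmono f₁) (hmono f₂)).1 hrange) i

end TopSimplex

/-! ### The realization as a colimit of simplices -/

namespace GeometricRealization

/-- The characteristic map of an `n`-simplex of `X`: the unit of the adjunction between geometric
realization and singular simplicial sets, evaluated at that simplex. -/
noncomputable def charMap {X : SSet.{u}} {n : ℕ} (s : X _⦋n⦌) :
    C(TopSimplex n, SSet.toTop.obj X) :=
  TopCat.toSSetObjEquiv _ _ ((sSetTopAdj.unit.app X).app _ s)

variable {X : SSet.{u}} {l m n : ℕ}

lemma charMap_map (f : ⦋m⦌ ⟶ ⦋n⦌) (s : X _⦋n⦌) :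
    charMap (X.map f.op s) = (charMap s).comp (TopSimplex.map f) := by
  have h := NatTrans.naturality_apply (sSetTopAdj.unit.app X) f.op s
  exact congrArg (TopCat.toSSetObjEquiv _ (op ⦋m⦌)) h

lemma charMap_map_apply (f : ⦋m⦌ ⟶ ⦋n⦌) (s : X _⦋n⦌) (a : TopSimplex m) :
    charMap (X.map f.op s) a = charMap s (TopSimplex.map f a) := by
  rw [charMap_map, ContinuousMap.comp_apply]

lemma exists_desc {Z : Type u} [TopologicalSpace Z] (c : ∀ n : ℕ, X _⦋n⦌ → C(TopSimplex n, Z))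
    (hc : ∀ (m n : ℕ) (f : ⦋m⦌ ⟶ ⦋n⦌) (s : X _⦋n⦌),
      c m (X.map f.op s) = (c n s).comp (TopSimplex.map f)) :
    ∃ F : C(SSet.toTop.obj X, Z), ∀ (n : ℕ) (s : X _⦋n⦌), F.comp (charMap s) = c n s := by
  let φ : X ⟶ TopCat.toSSet.obj (TopCat.of Z) :=
    { app := fun n => ↾(fun s => (TopCat.toSSetObjEquiv (TopCat.of Z) n).symm (c n.unop.len s))
      naturality := fun n m f => by
        ext s
        exact congrArg (TopCat.toSSetObjEquiv (TopCat.of Z) m).symm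
          (hc m.unop.len n.unop.len f.unop s) }
  let F : SSet.toTop.obj X ⟶ TopCat.of Z := (sSetTopAdj.homEquiv X (TopCat.of Z)).symm φ
  have hF : sSetTopAdj.unit.app X ≫ TopCat.toSSet.map F = φ :=
    (Adjunction.homEquiv_unit ..).symm.trans (Equiv.apply_symm_apply _ _)
  exact ⟨F.hom, fun n s => congrArg (fun ψ : X ⟶ TopCat.toSSet.obj (TopCat.of Z) =>
    TopCat.toSSetObjEquiv (TopCat.of Z) _ (ψ.app (op ⦋n⦌) s)) hF⟩

lemma hom_ext {Z : Type u} [TopologicalSpace Z] {F G : C(SSet.toTop.obj X, Z)}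
    (h : ∀ (n : ℕ) (s : X _⦋n⦌), F.comp (charMap s) = G.comp (charMap s)) : F = G := by
  suffices TopCat.ofHom F = TopCat.ofHom G from congrArg TopCat.Hom.hom this
  apply (sSetTopAdj.homEquiv X (TopCat.of Z)).injective
  ext n s
  exact (TopCat.toSSetObjEquiv (TopCat.of Z) n).injective (h n.unop.len s)

lemma exists_desc_fun {Z : Type u} (c : ∀ n : ℕ, X _⦋n⦌ → TopSimplex n → Z)
    (hc : ∀ (m n : ℕ) (f : ⦋m⦌ ⟶ ⦋n⦌) (s : X _⦋n⦌) (a),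
      c m (X.map f.op s) a = c n s (TopSimplex.map f a)) :
    ∃ F : SSet.toTop.obj X → Z, ∀ (n : ℕ) (s : X _⦋n⦌) a, F (charMap s a) = c n s a := by
  let _ : TopologicalSpace Z := ⊤
  obtain ⟨F, hF⟩ := exists_desc (X := X) (Z := Z) (fun n s => ⟨c n s, continuous_top⟩)
    (fun m n f s => ContinuousMap.ext fun a => hc m n f s a)
  exact ⟨F, fun n s a => DFunLike.congr_fun (hF n s) a⟩

lemma exists_charMap_eq (x : SSet.toTop.obj X) :
    ∃ (n : ℕ) (s : X _⦋n⦌) (a : TopSimplex n), charMap s a = x := by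
  let _ : TopologicalSpace (ULift.{u} Prop) := ⊤
  -- Two maps to an indiscrete space that agree on all simplices are equal.
  let F : C(SSet.toTop.obj X, ULift.{u} Prop) :=
    ⟨fun x => ⟨∃ (n : ℕ) (s : X _⦋n⦌) (a : TopSimplex n), charMap s a = x⟩, continuous_top⟩
  let G : C(SSet.toTop.obj X, ULift.{u} Prop) := ⟨fun _ => ⟨True⟩, continuous_top⟩
  have hFG : F = G := hom_ext fun n s => ContinuousMap.ext fun a =>
    congrArg ULift.up (propext (iff_true_intro ⟨n, s, a, rfl⟩))
  exact of_eq_true (congrArg ULift.down (DFunLike.congr_fun hFG x))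

lemma continuous_of_comp_charMap {Z : Type u} [TopologicalSpace Z] {g : SSet.toTop.obj X → Z}
    (hg : ∀ (n : ℕ) (s : X _⦋n⦌), Continuous (g ∘ charMap s)) : Continuous g := by
  obtain ⟨F, hF⟩ := exists_desc (X := X) (Z := Z) (fun n s => ⟨g ∘ charMap s, hg n s⟩)
    (fun m n f s => ContinuousMap.ext fun a => congrArg g (charMap_map_apply f s a))
  have hFg : F = g := by
    ext x
    obtain ⟨n, s, a, rfl⟩ := exists_charMap_eq x
    exact DFunLike.congr_fun (hF n s) a
  exact hFg ▸ F.continuous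

lemma isOpen_of_preimage_charMap {U : Set (SSet.toTop.obj X)}
    (hU : ∀ (n : ℕ) (s : X _⦋n⦌), IsOpen (charMap s ⁻¹' U)) : IsOpen U := by
  have h : Continuous fun x : SSet.toTop.obj X => ULift.up.{u} (x ∈ U) :=
    continuous_of_comp_charMap fun n s => continuous_uliftUp.comp (continuous_Prop.2 (hU n s))
  exact continuous_Prop.1 (continuous_uliftDown.comp h)

lemma isClosed_of_preimage_charMap {F : Set (SSet.toTop.obj X)}
    (hF : ∀ (n : ℕ) (s : X _⦋n⦌), IsClosed (charMap s ⁻¹' F)) : IsClosed F :=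
  ⟨isOpen_of_preimage_charMap fun n s => (hF n s).isOpen_compl⟩

/-! ### Normal forms of points -/

lemma exists_epi_comp_mono_eq (f : ⦋m⦌ ⟶ ⦋n⦌) :
    ∃ (k : ℕ) (e : ⦋m⦌ ⟶ ⦋k⦌) (i : ⦋k⦌ ⟶ ⦋n⦌) (_ : Epi e) (_ : Mono i), e ≫ i = f :=
  ⟨(Limits.image f).len, Limits.factorThruImage f, Limits.image.ι f, inferInstance, inferInstance,
    Limits.image.fac f⟩

lemma map_comp_op_apply (f : ⦋l⦌ ⟶ ⦋m⦌) (g : ⦋m⦌ ⟶ ⦋n⦌) (s : X _⦋n⦌) :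
    X.map (f ≫ g).op s = X.map f.op (X.map g.op s) := by
  rw [op_comp, Functor.map_comp, comp_apply]

lemma nonDegenerate_unique {k n₁ n₂ : ℕ} {f₁ : ⦋k⦌ ⟶ ⦋n₁⦌} {f₂ : ⦋k⦌ ⟶ ⦋n₂⦌} [Epi f₁] [Epi f₂]
    {s₁ : X _⦋n₁⦌} {s₂ : X _⦋n₂⦌} (h₁ : s₁ ∈ X.nonDegenerate n₁) (h₂ : s₂ ∈ X.nonDegenerate n₂)
    (h : X.map f₁.op s₁ = X.map f₂.op s₂) :
    (⟨n₁, f₁, s₁⟩ : Σ n : ℕ, (⦋k⦌ ⟶ ⦋n⦌) × X _⦋n⦌) = ⟨n₂, f₂, s₂⟩ := by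
  obtain rfl := X.unique_nonDegenerate_dim _ f₁ ⟨s₁, h₁⟩ rfl f₂ ⟨s₂, h₂⟩ h
  obtain rfl : s₁ = s₂ :=
    congrArg Subtype.val (X.unique_nonDegenerate_simplex _ f₁ ⟨s₁, h₁⟩ rfl f₂ ⟨s₂, h₂⟩ h)
  obtain rfl := X.unique_nonDegenerate_map _ f₁ ⟨s₁, h₁⟩ rfl f₂ ⟨s₁, h₂⟩ h
  rfl

/-- The normal forms of a point `a` of a simplex `s`: the nondegenerate simplices with an interior
point that arise by restricting `s` to the carrier of `a` and then removing degeneracies. -/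
def normalForms (s : X _⦋m⦌) (a : TopSimplex m) : Set (Σ n : ℕ, X _⦋n⦌ × TopSimplex n) :=
  {p | p.2.1 ∈ X.nonDegenerate p.1 ∧ ∃ (k : ℕ) (i : ⦋k⦌ ⟶ ⦋m⦌) (e : ⦋k⦌ ⟶ ⦋p.1⦌) (b : TopSimplex k),
    Mono i ∧ Epi e ∧ b.IsInterior ∧ TopSimplex.map i b = a ∧ TopSimplex.map e b = p.2.2 ∧
      X.map i.op s = X.map e.op p.2.1}

lemma normalForms_nonempty (s : X _⦋m⦌) (a : TopSimplex m) : (normalForms s a).Nonempty := by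
  obtain ⟨k, i, hi, b, hb, hab⟩ := a.exists_isInterior_map_eq
  obtain ⟨n, e, he, ⟨y, hy⟩, h⟩ := X.exists_nonDegenerate (X.map i.op s)
  exact ⟨⟨n, y, TopSimplex.map e b⟩, hy, k, i, e, b, hi, he, hb, hab, rfl, h⟩

lemma normalForms_subsingleton (s : X _⦋m⦌) (a : TopSimplex m) :
    (normalForms s a).Subsingleton := by
  rintro ⟨n₁, y₁, c₁⟩ ⟨hy₁, k₁, i₁, e₁, b₁, _, _, hb₁, hab₁, hc₁, h₁⟩
    ⟨n₂, y₂, c₂⟩ ⟨hy₂, k₂, i₂, e₂, b₂, _, _, hb₂, hab₂, hc₂, h₂⟩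
  dsimp only at *
  obtain rfl := hb₁.dim_unique hb₂ (hab₁.trans hab₂.symm)
  obtain rfl := hb₁.face_unique hb₂ (hab₁.trans hab₂.symm)
  obtain rfl := TopSimplex.map_injective_of_mono i₁ (hab₁.trans hab₂.symm)
  cases nonDegenerate_unique hy₁ hy₂ (h₁.symm.trans h₂)
  rw [← hc₁, ← hc₂]

lemma normalForms_map (f : ⦋m⦌ ⟶ ⦋n⦌) (s : X _⦋n⦌) (a : TopSimplex m) :
    normalForms (X.map f.op s) a = normalForms s (TopSimplex.map f a) := by
  have hsub : normalForms (X.map f.op s) a ⊆ normalForms s (TopSimplex.map f a) := by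
    rintro ⟨n₁, y₁, c₁⟩ ⟨hy₁, k₁, i₁, e₁, b₁, _, _, hb₁, hab₁, hc₁, h₁⟩
    dsimp only at *
    obtain ⟨l, e, i, _, hi, hei⟩ := exists_epi_comp_mono_eq (i₁ ≫ f)
    obtain ⟨n₂, e₂, he₂, ⟨y₂, hy₂⟩, h₂⟩ := X.exists_nonDegenerate (X.map i.op s)
    have hy : X.map (e ≫ e₂).op y₂ = X.map e₁.op y₁ := by
      rw [← h₁, ← map_comp_op_apply, ← hei, map_comp_op_apply, map_comp_op_apply, h₂]
    cases nonDegenerate_unique hy₂ hy₁ hy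
    refine ⟨hy₁, l, i, e₂, TopSimplex.map e b₁, hi, he₂, hb₁.map_of_epi e, ?_, ?_, h₂⟩
    · rw [← TopSimplex.map_comp_apply, hei, TopSimplex.map_comp_apply, hab₁]
    · rw [← TopSimplex.map_comp_apply]; exact hc₁
  refine hsub.antisymm fun p hp => ?_
  obtain ⟨q, hq⟩ := normalForms_nonempty (X.map f.op s) a
  rwa [normalForms_subsingleton _ _ hp (hsub hq)]

lemma normalForms_congr {s : X _⦋m⦌} {t : X _⦋n⦌} {a : TopSimplex m} {b : TopSimplex n}
    (h : charMap s a = charMap t b) : normalForms s a = normalForms t b := by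
  obtain ⟨F, hF⟩ := exists_desc_fun (X := X) (fun n s a => normalForms s a)
    (fun m n f s a => normalForms_map f s a)
  rw [← hF, ← hF, h]

lemma mem_normalForms_self {s : X _⦋n⦌} (hs : s ∈ X.nonDegenerate n) {a : TopSimplex n}
    (ha : a.IsInterior) : ⟨n, s, a⟩ ∈ normalForms s a :=
  ⟨hs, n, 𝟙 _, 𝟙 _, a, inferInstance, inferInstance, ha, TopSimplex.map_id_apply a,
    TopSimplex.map_id_apply a, rfl⟩

theorem exists_normalForm (x : SSet.toTop.obj X) :
    ∃ (n : ℕ) (s : X _⦋n⦌) (a : TopSimplex n),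
      s ∈ X.nonDegenerate n ∧ a.IsInterior ∧ charMap s a = x := by
  obtain ⟨m, t, b, rfl⟩ := exists_charMap_eq x
  obtain ⟨⟨n, s, a⟩, hs, k, i, e, c, _, _, hc, rfl, _, h⟩ := normalForms_nonempty t b
  refine ⟨n, s, TopSimplex.map e c, hs, hc.map_of_epi e, ?_⟩
  rw [← charMap_map_apply, ← charMap_map_apply, h]

lemma exists_of_charMap_eq {t : X _⦋m⦌} {b : TopSimplex m} {s : X _⦋n⦌}
    (hs : s ∈ X.nonDegenerate n) {a : TopSimplex n} (ha : a.IsInterior)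
    (h : charMap t b = charMap s a) :
    ∃ (k : ℕ) (i : ⦋k⦌ ⟶ ⦋m⦌) (e : ⦋k⦌ ⟶ ⦋n⦌) (c : TopSimplex k), Mono i ∧ Epi e ∧
      TopSimplex.map i c = b ∧ TopSimplex.map e c = a ∧ X.map i.op t = X.map e.op s := by
  obtain ⟨-, k, i, e, c, hi, he, -, h'⟩ := normalForms_congr h ▸ mem_normalForms_self hs ha
  exact ⟨k, i, e, c, hi, he, h'⟩

theorem normalForm_unique {n₁ n₂ : ℕ} {s₁ : X _⦋n₁⦌} {s₂ : X _⦋n₂⦌}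
    (h₁ : s₁ ∈ X.nonDegenerate n₁) (h₂ : s₂ ∈ X.nonDegenerate n₂)
    {a₁ : TopSimplex n₁} {a₂ : TopSimplex n₂} (ha₁ : a₁.IsInterior) (ha₂ : a₂.IsInterior)
    (h : charMap s₁ a₁ = charMap s₂ a₂) :
    (⟨n₁, s₁, a₁⟩ : Σ n : ℕ, X _⦋n⦌ × TopSimplex n) = ⟨n₂, s₂, a₂⟩ :=
  normalForms_subsingleton s₂ a₂ (normalForms_congr h ▸ mem_normalForms_self h₁ ha₁)
    (mem_normalForms_self h₂ ha₂)

end GeometricRealization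

/-! ### Properties of homotopy classes of paths -/

/-- A property of homotopy classes of paths in `Y`, with arbitrary endpoints. -/
abbrev PathProperty (Y : Type*) [TopologicalSpace Y] : Type _ :=
  ∀ ⦃y y' : Y⦄, Path.Homotopic.Quotient y y' → Prop

namespace PathProperty

variable {Y : Type*} [TopologicalSpace Y] {T : PathProperty Y}

/-- A property of homotopy classes of paths is closed under concatenation. -/
def TransClosed (T : PathProperty Y) : Prop :=
  ∀ ⦃x y z : Y⦄ ⦃p : Path.Homotopic.Quotient x y⦄ ⦃q : Path.Homotopic.Quotient y z⦄,
    T p → T q → T (p.trans q)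

/-- A property of homotopy classes of paths, for a path whose endpoints are not specified. -/
def HoldsFor (T : PathProperty Y) (f : C(I, Y)) : Prop :=
  T (.mk (⟨f, rfl, rfl⟩ : Path (f 0) (f 1)))

lemma cast_iff {x y x' y' : Y} (p : Path.Homotopic.Quotient x y) (hx : x' = x) (hy : y' = y) :
    T (p.cast hx hy) ↔ T p := by
  subst hx hy
  rw [Path.Homotopic.Quotient.cast_rfl_rfl]

lemma holdsFor_coe_iff {x y : Y} (p : Path x y) : T.HoldsFor (p : C(I, Y)) ↔ T (.mk p) :=
  cast_iff (.mk p) p.source p.target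

theorem TransClosed.holdsFor_of_cover (hT : T.TransClosed) (f : C(I, Y)) {ι : Type*} {c : ι → Set I}
    (hc : ∀ i, IsOpen (c i)) (hcov : Set.univ ⊆ ⋃ i, c i)
    (h : ∀ (i : ι) (g : C(I, I)), (∀ t, g t ∈ c i) → T.HoldsFor (f.comp g)) : T.HoldsFor f := by
  obtain ⟨t, ht0, htmono, ⟨N, hN⟩, ht⟩ :=
    exists_monotone_Icc_subset_open_cover_unitInterval hc hcov
  let p : Path (f 0) (f 1) := ⟨f, rfl, rfl⟩
  have hpiece : ∀ n, T (.mk (p.subpath (t n) (t (n + 1)))) := by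
    intro n
    obtain ⟨i, hi⟩ := ht n
    refine (holdsFor_coe_iff _).1
      (h i ⟨Set.Icc.convexComb (t n) (t (n + 1)), by fun_prop⟩ fun s => hi ?_)
    rw [← Set.uIcc_of_le (htmono n.le_succ), ← Path.range_subpathAux]
    exact ⟨s, rfl⟩
  have hinit : ∀ n, T (.mk (p.subpath 0 (t (n + 1)))) := by
    intro n
    induction n with
    | zero =>
      have hfirst := hpiece 0
      rwa [ht0] at hfirst
    | succ n ih =>
      have htrans := hT ih (hpiece (n + 1))
      rwa [← Path.Homotopic.Quotient.mk_trans,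
        Path.Homotopic.Quotient.eq.2 ⟨Path.Homotopy.subpathTransSubpath p 0 _ _⟩] at htrans
  have hend := hinit N
  rwa [hN (N + 1) N.le_succ, Path.subpath_zero_one] at hend

theorem TransClosed.holdsFor_of_homotopy (hT : T.TransClosed) {f g : C(I, Y)} (H : f.Homotopy g)
    (h0 : T (.mk (H.evalAt 0))) (h1 : T (.mk (H.evalAt 1).symm)) (hg : T.HoldsFor g) :
    T.HoldsFor f := by
  let pf : Path (f 0) (f 1) := ⟨f, rfl, rfl⟩
  let pg : Path (g 0) (g 1) := ⟨g, rfl, rfl⟩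
  have hsquare : (Path.Homotopic.Quotient.mk pf).trans (.mk (H.evalAt 1)) =
      (Path.Homotopic.Quotient.mk (H.evalAt 0)).trans (.mk pg) :=
    Path.Homotopic.Quotient.eq.2
      (Path.Homotopic.map_trans_evalAt H (⟨ContinuousMap.id I, rfl, rfl⟩ : Path (0 : I) 1))
  have hf : Path.Homotopic.Quotient.mk pf =
      ((Path.Homotopic.Quotient.mk (H.evalAt 0)).trans (.mk pg)).trans (.mk (H.evalAt 1).symm) := by
    rw [← hsquare, Path.Homotopic.Quotient.mk_symm, Path.Homotopic.Quotient.trans_assoc,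
      Path.Homotopic.Quotient.trans_symm, Path.Homotopic.Quotient.trans_refl]
  have := hT (hT h0 hg) h1
  rwa [← hf] at this

end PathProperty

/-! ### Skeleta -/

namespace GeometricRealization

variable {X : SSet.{u}} {n : ℕ}

lemma injective_map_op_of_epi {k : ℕ} (e : ⦋k⦌ ⟶ ⦋n⦌) [Epi e] :
    Function.Injective (X.map e.op) := by
  obtain ⟨⟨he⟩⟩ := isSplitEpi_of_epi e
  refine Function.LeftInverse.injective (g := X.map he.section_.op) fun s => ?_
  rw [← map_comp_op_apply, he.id]
  simp

theorem isClosed_of_cells {F : Set (SSet.toTop.obj X)} (D : ∀ n : ℕ, X _⦋n⦌ → Set (TopSimplex n))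
    (hD : ∀ n s, IsClosed (D n s)) (hDF : ∀ n s, ∀ a ∈ D n s, charMap s a ∈ F)
    (hFD : ∀ (n : ℕ) (s : X _⦋n⦌) (a : TopSimplex n),
      s ∈ X.nonDegenerate n → a.IsInterior → charMap s a ∈ F → a ∈ D n s) :
    IsClosed F := by
  refine isClosed_of_preimage_charMap fun m t => ?_
  -- Only finitely many pairs of a face `i` of `t` and a degeneracy operator `e` can occur.
  let A (l n : Fin (m + 1)) (i : ⦋l⦌ ⟶ ⦋m⦌) (e : ⦋l⦌ ⟶ ⦋n⦌) : Set (TopSimplex m) :=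
    ⋃ s ∈ {s : X _⦋n⦌ | Epi e ∧ X.map i.op t = X.map e.op s},
      TopSimplex.map i '' (TopSimplex.map e ⁻¹' D n s)
  have hA : ∀ l n i e, IsClosed (A l n i e) := by
    intro l n i e
    refine Set.Finite.isClosed_biUnion (Set.Subsingleton.finite ?_) fun s _ => ?_
    · rintro s ⟨_, hs⟩ s' ⟨_, hs'⟩
      exact injective_map_op_of_epi e (hs.symm.trans hs')
    · exact (((hD _ s).preimage (TopSimplex.map e).continuous).isCompact.image
        (TopSimplex.map i).continuous).isClosed
  have hpre : charMap t ⁻¹' F = ⋃ l, ⋃ n, ⋃ i, ⋃ e, A l n i e := by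
    ext b
    simp only [Set.mem_iUnion]
    constructor
    · intro hb
      obtain ⟨n, s, a, hs, ha, h⟩ := exists_normalForm (charMap t b)
      obtain ⟨l, i, e, c, hi, he, hc, hc', hst⟩ := exists_of_charMap_eq hs ha h.symm
      have hlm : l ≤ m := SimplexCategory.len_le_of_mono i
      have hnl : n ≤ l := SimplexCategory.len_le_of_epi e
      refine ⟨⟨l, by omega⟩, ⟨n, by omega⟩, i, e, Set.mem_biUnion ⟨he, hst⟩ ⟨c, ?_, hc⟩⟩
      rw [Set.mem_preimage, hc']
      exact hFD n s a hs ha (h ▸ hb)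
    · rintro ⟨l, n, i, e, hb⟩
      obtain ⟨s, ⟨_, hst⟩, c, hc, rfl⟩ := Set.mem_iUnion₂.1 hb
      rw [Set.mem_preimage, ← charMap_map_apply, hst, charMap_map_apply]
      exact hDF _ _ _ hc
  rw [hpre]
  exact isClosed_iUnion_of_finite fun l => isClosed_iUnion_of_finite fun n =>
    isClosed_iUnion_of_finite fun i => isClosed_iUnion_of_finite fun e => hA l n i e

variable (X) in
/-- The union of all simplices of dimension less than `n` in the realization; the strict
inequality makes the induction over skeleta start with the empty set. -/
def skel (n : ℕ) : Set (SSet.toTop.obj X) :=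
  {x | ∃ (k : ℕ) (s : X _⦋k⦌) (a : TopSimplex k), k < n ∧ charMap s a = x}

lemma dim_lt_of_mem_skel {k : ℕ} {s : X _⦋k⦌} (hs : s ∈ X.nonDegenerate k) {a : TopSimplex k}
    (ha : a.IsInterior) (h : charMap s a ∈ skel X n) : k < n := by
  obtain ⟨m, t, b, hm, h⟩ := h
  obtain ⟨l, i, e, c, hi, he, -⟩ := exists_of_charMap_eq hs ha h
  have hlm : l ≤ m := SimplexCategory.len_le_of_mono i
  have hkl : k ≤ l := SimplexCategory.len_le_of_epi e
  omega

lemma charMap_mem_skel_of_not_isInterior (s : X _⦋n⦌) {a : TopSimplex n} (ha : ¬ a.IsInterior) :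
    charMap s a ∈ skel X n := by
  obtain ⟨k, f, hf, b, hb, rfl⟩ := a.exists_isInterior_map_eq
  refine ⟨k, X.map f.op s, b, ?_, charMap_map_apply f s b⟩
  refine lt_of_le_of_ne (SimplexCategory.len_le_of_mono f) ?_
  rintro rfl
  obtain rfl := SimplexCategory.eq_id_of_mono f
  exact ha (by rwa [TopSimplex.map_id_apply])

lemma mem_skel_succ_iff {x : SSet.toTop.obj X} : x ∈ skel X (n + 1) ↔
    x ∈ skel X n ∨ ∃ s ∈ X.nonDegenerate n, ∃ a : TopSimplex n, charMap s a = x := by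
  constructor
  · intro hx
    obtain ⟨k, s, a, hs, ha, rfl⟩ := exists_normalForm x
    rcases Nat.lt_succ_iff_lt_or_eq.1 (dim_lt_of_mem_skel hs ha hx) with hk | rfl
    · exact Or.inl ⟨k, s, a, hk, rfl⟩
    · exact Or.inr ⟨s, hs, a, rfl⟩
  · rintro (⟨k, s, a, hk, rfl⟩ | ⟨s, -, a, rfl⟩)
    · exact ⟨k, s, a, hk.trans n.lt_succ_self, rfl⟩
    · exact ⟨n, s, a, n.lt_succ_self, rfl⟩

lemma continuousOn_skel {Z : Type*} [TopologicalSpace Z] {f : SSet.toTop.obj X → Z}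
    (hf : ∀ (k : ℕ) (s : X _⦋k⦌), k < n → Continuous (f ∘ charMap s)) :
    ContinuousOn f (skel X n) := by
  rw [continuousOn_iff_isClosed]
  intro K hK
  refine ⟨f ⁻¹' K ∩ skel X n, ?_, by rw [Set.inter_assoc, Set.inter_self]⟩
  refine isClosed_of_cells (fun k s => {a | k < n ∧ f (charMap s a) ∈ K}) ?_ ?_ ?_
  · intro k s
    by_cases hk : k < n
    · simp only [hk, true_and]
      exact hK.preimage (hf k s hk)
    · simp [hk]
  · rintro k s a ⟨hk, ha⟩
    exact ⟨ha, k, s, a, hk, rfl⟩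
  · rintro k s a hs ha ⟨hK, hskel⟩
    exact ⟨dim_lt_of_mem_skel hs ha hskel, hK⟩

lemma continuousOn_skel_succ {Z : Type*} [TopologicalSpace Z] {f : SSet.toTop.obj X → Z}
    (hf : ∀ (k : ℕ) (s : X _⦋k⦌), k < n → Continuous (f ∘ charMap s))
    (hf' : ∀ s ∈ X.nonDegenerate n, Continuous (f ∘ charMap s)) :
    ContinuousOn f (skel X (n + 1)) := by
  refine continuousOn_skel fun k s hk => ?_
  rcases Nat.lt_succ_iff_lt_or_eq.1 hk with hk | rfl
  · exact hf k s hk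
  by_cases hs : s ∈ X.nonDegenerate k
  · exact hf' s hs
  · rw [← SSet.mem_degenerate_iff_notMem_nonDegenerate] at hs
    obtain ⟨l, hl, e, t, rfl⟩ := hs
    rw [charMap_map]
    exact (hf l t hl).comp (TopSimplex.map e).continuous

theorem exists_extension_skel_succ {Z : Type*} [TopologicalSpace Z] {f₀ : SSet.toTop.obj X → Z}
    (hf₀ : ∀ (k : ℕ) (s : X _⦋k⦌), k < n → Continuous (f₀ ∘ charMap s))
    (g : X _⦋n⦌ → C(TopSimplex n, Z))
    (hg : ∀ s a, ¬ TopSimplex.IsInterior a → g s a = f₀ (charMap s a)) :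
    ∃ f : SSet.toTop.obj X → Z, ContinuousOn f (skel X (n + 1)) ∧ (∀ x ∈ skel X n, f x = f₀ x) ∧
      ∀ s ∈ X.nonDegenerate n, ∀ a, f (charMap s a) = g s a := by
  classical
  let InCell (x : SSet.toTop.obj X) (p : X _⦋n⦌ × TopSimplex n) : Prop :=
    p.1 ∈ X.nonDegenerate n ∧ p.2.IsInterior ∧ charMap p.1 p.2 = x
  let f : SSet.toTop.obj X → Z := fun x =>
    if h : ∃ p, InCell x p then g h.choose.1 h.choose.2 else f₀ x
  have hskel : ∀ x ∈ skel X n, f x = f₀ x := by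
    refine fun x hx => dif_neg ?_
    rintro ⟨⟨s, a⟩, hs, ha, rfl⟩
    exact lt_irrefl _ (dim_lt_of_mem_skel hs ha hx)
  have hcell : ∀ s ∈ X.nonDegenerate n, ∀ a, f (charMap s a) = g s a := by
    intro s hs a
    by_cases ha : a.IsInterior
    · have h : ∃ p, InCell (charMap s a) p := ⟨⟨s, a⟩, hs, ha, rfl⟩
      obtain ⟨hs', ha', hsa⟩ := h.choose_spec
      have hchoose : h.choose = (s, a) := by
        simpa only [Sigma.mk.injEq, heq_eq_eq, true_and] using normalForm_unique hs' hs ha' ha hsa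
      rw [show f (charMap s a) = g h.choose.1 h.choose.2 from dif_pos h, hchoose]
    · rw [hskel _ (charMap_mem_skel_of_not_isInterior s ha), hg s a ha]
  refine ⟨f, continuousOn_skel_succ (fun k s hk => ?_) fun s hs => ?_, hskel, hcell⟩
  · rw [show f ∘ charMap s = f₀ ∘ charMap s from funext fun a => hskel _ ⟨k, s, a, hk, rfl⟩]
    exact hf₀ k s hk
  · rw [show f ∘ charMap s = g s from funext (hcell s hs)]
    exact (g s).continuous

lemma isClosed_range_of_dim_injective {ι : Type*} (p : ι → Σ k : ℕ, X _⦋k⦌ × TopSimplex k)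
    (hp : ∀ j, (p j).2.1 ∈ X.nonDegenerate (p j).1) (hp' : ∀ j, (p j).2.2.IsInterior)
    (hdim : Function.Injective fun j => (p j).1) :
    IsClosed (Set.range fun j => charMap (p j).2.1 (p j).2.2) := by
  refine isClosed_of_cells (fun k s => {a | ∃ j, p j = ⟨k, s, a⟩}) ?_ ?_ ?_
  · intro k s
    refine Set.Subsingleton.isClosed ?_
    rintro a ⟨j, hj⟩ b ⟨j', hj'⟩
    obtain rfl : j = j' := hdim (by simp [hj, hj'])
    simpa [hj] using hj'
  · rintro k s a ⟨j, hj⟩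
    refine ⟨j, ?_⟩
    change charMap (p j).2.1 (p j).2.2 = _
    rw [hj]
  · rintro k s a hs ha ⟨j, hj⟩
    exact ⟨j, normalForm_unique (hp j) hs (hp' j) ha hj⟩

theorem exists_subset_skel_of_isCompact {K : Set (SSet.toTop.obj X)} (hK : IsCompact K) :
    ∃ n, K ⊆ skel X n := by
  let dims : Set ℕ := {k | ∃ s ∈ X.nonDegenerate k, ∃ a : TopSimplex k,
    a.IsInterior ∧ charMap s a ∈ K}
  choose s hs a ha hsaK using fun k : dims => k.2
  let x : dims → SSet.toTop.obj X := fun k => charMap (s k) (a k)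
  have hclosed (J : Set dims) : IsClosed (x '' J) := by
    rw [Set.image_eq_range]
    exact isClosed_range_of_dim_injective (fun k : J => ⟨k.1, s k, a k⟩) (fun k => hs k)
      (fun k => ha k) (Subtype.val_injective.comp Subtype.val_injective)
  have hinj : Function.Injective x := fun k k' h =>
    Subtype.ext (congrArg Sigma.fst (normalForm_unique (hs k) (hs k') (ha k) (ha k') h))
  have hdiscrete : IsDiscrete (Set.range x) := by
    refine ⟨discreteTopology_iff_forall_isClosed.2 fun B => ?_⟩
    rw [isClosed_induced_iff]
    refine ⟨x '' (x ⁻¹' (Subtype.val '' B)), hclosed _, ?_⟩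
    ext ⟨_, k, rfl⟩
    simp [hinj.eq_iff]
  have hcompact : IsCompact (Set.range x) :=
    hK.of_isClosed_subset (Set.image_univ ▸ hclosed Set.univ) (Set.range_subset_iff.2 hsaK)
  have hfinite : dims.Finite :=
    (Set.finite_range_iff hinj).1 (hcompact.finite hdiscrete)
  obtain ⟨n, hn⟩ := hfinite.bddAbove
  refine ⟨n + 1, fun y hy => ?_⟩
  obtain ⟨k, s, a, hs, ha, rfl⟩ := exists_normalForm y
  exact ⟨k, s, a, Nat.lt_succ_of_le (hn ⟨s, hs, a, ha, hy⟩), rfl⟩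

end GeometricRealization

/-! ### Deformations of the simplex -/

namespace TopSimplex

variable {n : ℕ}

lemma continuous_coord (i : Fin (n + 1)) : Continuous fun a : TopSimplex n => a i :=
  (continuous_apply i).comp continuous_subtype_val

/-- The straight-line homotopy from the identity to a self-map that fixes the boundary. -/
noncomputable def lineHomotopy (Φ : C(TopSimplex n, TopSimplex n))
    (hΦ : ∀ a, ¬ IsInterior a → Φ a = a) :
    (ContinuousMap.id (TopSimplex n)).HomotopyRel Φ {a | ¬ a.IsInterior} where
  toFun p := ⟨(1 - (p.1 : ℝ)) • ⇑p.2 + (p.1 : ℝ) • ⇑(Φ p.2),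
    convex_stdSimplex ℝ _ p.2.2 (Φ p.2).2 (sub_nonneg.2 p.1.2.2) p.1.2.1 (sub_add_cancel _ _)⟩
  continuous_toFun := by
    refine Continuous.subtype_mk (continuous_pi fun i => ?_) _
    have hfst := (continuous_coord i).comp (continuous_snd (X := I) (Y := TopSimplex n))
    have hsnd := (continuous_coord i).comp (Φ.continuous.comp (continuous_snd (X := I)))
    have htime := continuous_subtype_val.comp (continuous_fst (X := I) (Y := TopSimplex n))
    exact ((continuous_const.sub htime).mul hfst).add (htime.mul hsnd)
  map_zero_left a := by
    refine Subtype.ext ?_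
    simp only [Set.Icc.coe_zero, sub_zero, one_smul, zero_smul, add_zero]
    rfl
  map_one_left a := by
    refine Subtype.ext ?_
    simp only [Set.Icc.coe_one, sub_self, one_smul, zero_smul, zero_add]
    rfl
  prop' t a ha := by
    refine Subtype.ext ?_
    simp only [ContinuousMap.coe_mk, hΦ a ha, ← add_smul, sub_add_cancel, one_smul]
    rfl

/-- The distance to the boundary as measured by the smallest barycentric coordinate, normalized to
be `1` at the barycenter. -/
noncomputable def depth (a : TopSimplex n) : ℝ :=
  (n + 1) * Finset.univ.inf' Finset.univ_nonempty a

lemma continuous_depth : Continuous (depth (n := n)) :=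
  continuous_const.mul (Continuous.finset_inf'_apply _ fun i _ => continuous_coord i)

lemma depth_le (a : TopSimplex n) (i : Fin (n + 1)) : depth a ≤ (n + 1) * a i :=
  mul_le_mul_of_nonneg_left (Finset.inf'_le _ (Finset.mem_univ i)) (by positivity)

lemma exists_depth_eq (a : TopSimplex n) : ∃ i, depth a = (n + 1) * a i := by
  obtain ⟨i, -, hi⟩ := Finset.exists_mem_eq_inf' Finset.univ_nonempty a
  exact ⟨i, congrArg _ hi⟩

lemma depth_nonneg (a : TopSimplex n) : 0 ≤ depth a := by
  obtain ⟨i, hi⟩ := exists_depth_eq a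
  exact hi ▸ mul_nonneg (by positivity) (stdSimplex.zero_le a i)

lemma depth_le_one (a : TopSimplex n) : depth a ≤ 1 := by
  have hn : (0 : ℝ) < n + 1 := by positivity
  have hsum : ∑ _i : Fin (n + 1), depth a ≤ ∑ i, (n + 1) * a i :=
    Finset.sum_le_sum fun i _ => depth_le a i
  rw [← Finset.mul_sum, stdSimplex.sum_eq_one] at hsum
  simpa [hn] using hsum

lemma isInterior_iff_depth_pos {a : TopSimplex n} : a.IsInterior ↔ 0 < depth a := by
  have hn : (0 : ℝ) < n + 1 := by positivity
  constructor
  · intro ha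
    obtain ⟨i, hi⟩ := exists_depth_eq a
    exact hi ▸ mul_pos hn (ha i)
  · exact fun ha i => pos_of_mul_pos_right (ha.trans_le (depth_le a i)) hn.le

lemma depth_eq_zero {a : TopSimplex n} (ha : ¬ a.IsInterior) : depth a = 0 :=
  le_antisymm (not_lt.1 (isInterior_iff_depth_pos.not.1 ha)) (depth_nonneg a)

/-- Rescaling around the barycenter by a factor `r` that depends on the depth. -/
noncomputable def radial (r : C(ℝ, ℝ)) (h0 : ∀ t, 0 ≤ r t)
    (h1 : ∀ t, 0 ≤ t → t ≤ 1 → r t * (1 - t) ≤ 1) : C(TopSimplex n, TopSimplex n) where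
  toFun a := ⟨fun i => (1 - r (depth a)) / (n + 1) + r (depth a) * a i, by
    have hn : (0 : ℝ) < n + 1 := by positivity
    constructor
    · intro i
      have hfactor := h1 _ (depth_nonneg a) (depth_le_one a)
      have hcoord := mul_le_mul_of_nonneg_left (depth_le a i) (h0 (depth a))
      beta_reduce
      rw [div_add' _ _ _ hn.ne']
      exact div_nonneg (by linarith) hn.le
    · rw [Finset.sum_add_distrib, ← Finset.mul_sum, stdSimplex.sum_eq_one, Finset.sum_const,
        Finset.card_fin, nsmul_eq_mul, Nat.cast_succ, mul_div_cancel₀ _ hn.ne']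
      ring⟩
  continuous_toFun := by
    have hr := r.continuous.comp (continuous_depth (n := n))
    refine Continuous.subtype_mk (continuous_pi fun i => ?_) _
    exact ((continuous_const.sub hr).div_const _).add (hr.mul (continuous_coord i))

section

variable {r : C(ℝ, ℝ)} {h0 : ∀ t, 0 ≤ r t} {h1 : ∀ t, 0 ≤ t → t ≤ 1 → r t * (1 - t) ≤ 1}

lemma radial_apply (a : TopSimplex n) (i : Fin (n + 1)) :
    radial r h0 h1 a i = (1 - r (depth a)) / (n + 1) + r (depth a) * a i := rfl

lemma depth_radial (a : TopSimplex n) :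
    depth (radial r h0 h1 a) ≤ 1 - r (depth a) * (1 - depth a) := by
  have hn : (n + 1 : ℝ) ≠ 0 := by positivity
  obtain ⟨i, hi⟩ := exists_depth_eq a
  refine (depth_le _ i).trans_eq ?_
  rw [radial_apply, mul_add, mul_div_cancel₀ _ hn, mul_left_comm, ← hi]
  ring

lemma radial_of_not_isInterior (hr : r 0 = 1) {a : TopSimplex n} (ha : ¬ a.IsInterior) :
    radial r h0 h1 a = a := by
  ext i
  rw [radial_apply, depth_eq_zero ha, hr]
  simp

end

lemma exists_expand (n : ℕ) : ∃ Φ : C(TopSimplex n, TopSimplex n),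
    (∀ a, ¬ IsInterior a → Φ a = a) ∧ ∀ a, depth a < 1 / 2 → ¬ (Φ a).IsInterior := by
  have hpos : ∀ t : ℝ, 0 < max (1 - t) (1 / 2) := fun t =>
    lt_max_of_lt_right (by norm_num)
  let r : C(ℝ, ℝ) := ⟨fun t => (max (1 - t) (1 / 2))⁻¹,
    Continuous.inv₀ (by fun_prop) fun t => (hpos t).ne'⟩
  have h0 : ∀ t, 0 ≤ r t := fun t => inv_nonneg.2 (hpos t).le
  have h1 : ∀ t, 0 ≤ t → t ≤ 1 → r t * (1 - t) ≤ 1 := fun t _ _ =>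
    (inv_mul_le_iff₀ (hpos t)).2 ((le_max_left _ _).trans_eq (mul_one _).symm)
  have hr : r 0 = 1 := show (max (1 - (0 : ℝ)) (1 / 2))⁻¹ = 1 by norm_num
  refine ⟨radial r h0 h1, fun a ha => radial_of_not_isInterior hr ha, fun a ha => ?_⟩
  have hra : r (depth a) * (1 - depth a) = 1 := by
    change (max (1 - depth a) (1 / 2))⁻¹ * (1 - depth a) = 1
    rw [max_eq_left (by linarith)]
    exact inv_mul_cancel₀ (by linarith)
  rw [isInterior_iff_depth_pos, not_lt]
  exact (depth_radial a).trans (by rw [hra, sub_self])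

lemma exists_collapse (n : ℕ) : ∃ (Φ : C(TopSimplex n, TopSimplex n)) (b : TopSimplex n),
    (∀ a, ¬ IsInterior a → Φ a = a) ∧ ∀ a, 1 / 4 < depth a → Φ a = b := by
  let r : C(ℝ, ℝ) := ⟨fun t => max (1 - 4 * t) 0, by fun_prop⟩
  have h0 : ∀ t, 0 ≤ r t := fun t => le_max_right _ _
  have h1 : ∀ t, 0 ≤ t → t ≤ 1 → r t * (1 - t) ≤ 1 := fun t ht ht' =>
    mul_le_one₀ (max_le (by linarith) zero_le_one) (by linarith) (by linarith)
  have hr : r 0 = 1 := show max (1 - 4 * (0 : ℝ)) 0 = 1 by norm_num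
  refine ⟨radial r h0 h1, stdSimplex.barycenter,
    fun a ha => radial_of_not_isInterior hr ha, fun a ha => ?_⟩
  have hra : r (depth a) = 0 := max_eq_right (by linarith)
  ext i
  rw [radial_apply, hra, sub_zero, zero_mul, add_zero, one_div]
  exact ((stdSimplex.barycenter_apply i).trans (by simp)).symm

end TopSimplex

/-! ### Generation of paths by simplices -/

namespace GeometricRealization

open PathProperty

variable {X : SSet.{u}} {n : ℕ}

/-- A family of paths `h x` in the realization, for `x` in the `n`-dimensional skeleton, which is
constant in lower dimensions and follows a given homotopy `H` in all `n`-dimensional cells. -/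
structure IsCellDeformation {Φ : C(TopSimplex n, TopSimplex n)}
    (H : (ContinuousMap.id (TopSimplex n)).HomotopyRel Φ {a | ¬ a.IsInterior})
    (h : SSet.toTop.obj X → C(I, SSet.toTop.obj X)) : Prop where
  continuousOn : ContinuousOn h (skel X (n + 1))
  eq_of_mem_skel : ∀ x ∈ skel X n, ∀ t, h x t = x
  eq_charMap : ∀ s ∈ X.nonDegenerate n, ∀ a t, h (charMap s a) t = charMap s (H (t, a))

section

variable {Φ : C(TopSimplex n, TopSimplex n)}
  {H : (ContinuousMap.id (TopSimplex n)).HomotopyRel Φ {a | ¬ a.IsInterior}}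

variable (X H) in
lemma exists_isCellDeformation :
    ∃ h : SSet.toTop.obj X → C(I, SSet.toTop.obj X), IsCellDeformation H h := by
  obtain ⟨h, hcont, hskel, hcell⟩ := exists_extension_skel_succ (X := X) (n := n)
    (f₀ := fun x => ContinuousMap.const I x)
    (fun k s _ => ContinuousMap.continuous_const'.comp (charMap s).continuous)
    (fun s => ((charMap s).comp (H.toContinuousMap.comp .prodSwap)).curry)
    (fun s a ha => ContinuousMap.ext fun t => congrArg (charMap s) (H.eq_fst t ha))
  exact ⟨h, hcont, fun x hx t => DFunLike.congr_fun (hskel x hx) t,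
    fun s hs a t => DFunLike.congr_fun (hcell s hs a) t⟩

variable {h : SSet.toTop.obj X → C(I, SSet.toTop.obj X)}

lemma IsCellDeformation.exists_charMap_comp_eq (hh : IsCellDeformation H h)
    {x : SSet.toTop.obj X} (hx : x ∈ skel X (n + 1)) :
    ∃ (k : ℕ) (s : X _⦋k⦌) (q : C(I, TopSimplex k)), h x = (charMap s).comp q := by
  rcases mem_skel_succ_iff.1 hx with hx | ⟨s, hs, a, rfl⟩
  · obtain ⟨k, s, a, -, rfl⟩ := id hx
    exact ⟨k, s, .const _ a, ContinuousMap.ext (hh.eq_of_mem_skel _ hx)⟩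
  · exact ⟨n, s, H.evalAt a, ContinuousMap.ext (hh.eq_charMap s hs a)⟩

lemma IsCellDeformation.apply_zero (hh : IsCellDeformation H h) {x : SSet.toTop.obj X}
    (hx : x ∈ skel X (n + 1)) : h x 0 = x := by
  rcases mem_skel_succ_iff.1 hx with hx | ⟨s, hs, a, rfl⟩
  · exact hh.eq_of_mem_skel x hx 0
  · rw [hh.eq_charMap s hs]
    exact congrArg (charMap s) (H.apply_zero a)

variable {T : PathProperty (SSet.toTop.obj X)}

lemma IsCellDeformation.holdsFor (hh : IsCellDeformation H h) (hT : T.TransClosed)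
    (hs : ∀ (k : ℕ) (s : X _⦋k⦌) (q : C(I, TopSimplex k)), T.HoldsFor ((charMap s).comp q))
    {f g : C(I, SSet.toTop.obj X)} (hf : ∀ t, f t ∈ skel X (n + 1)) (hg : ∀ t, h (f t) 1 = g t)
    (hgT : T.HoldsFor g) : T.HoldsFor f := by
  let K : C(I, C(I, SSet.toTop.obj X)) :=
    ⟨fun t => h (f t), hh.continuousOn.comp_continuous f.continuous hf⟩
  let F : f.Homotopy g :=
    { toContinuousMap := K.uncurry.comp .prodSwap
      map_zero_left := fun t => hh.apply_zero (hf t)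
      map_one_left := hg }
  have htrack : ∀ t, T (.mk (F.evalAt t)) ∧ T (.mk (F.evalAt t).symm) := by
    intro t
    obtain ⟨k, s, q, hq⟩ := hh.exists_charMap_comp_eq (hf t)
    constructor
    · refine (holdsFor_coe_iff (T := T) _).1 ?_
      change T.HoldsFor (h (f t))
      exact hq ▸ hs k s q
    · refine (holdsFor_coe_iff (T := T) _).1 ?_
      change T.HoldsFor ((h (f t)).comp ⟨σ, continuous_symm⟩)
      rw [hq, ContinuousMap.comp_assoc]
      exact hs k s _
  exact hT.holdsFor_of_homotopy F (htrack 0).1 (htrack 1).2 hgT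

end

lemma exists_depth (n : ℕ) (A : Set (X _⦋n⦌)) :
    ∃ μ : SSet.toTop.obj X → ℝ, ContinuousOn μ (skel X (n + 1)) ∧
      (∀ s ∈ X.nonDegenerate n, s ∈ A → ∀ a, μ (charMap s a) = TopSimplex.depth a) ∧
      ∀ x ∈ skel X (n + 1), 0 < μ x → ∃ s ∈ X.nonDegenerate n, s ∈ A ∧ ∃ a, charMap s a = x := by
  classical
  obtain ⟨μ, hcont, hskel, hcell⟩ := exists_extension_skel_succ (X := X) (n := n)
    (f₀ := fun _ => (0 : ℝ)) (fun _ _ _ => continuous_const)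
    (fun s => if s ∈ A then ⟨_, TopSimplex.continuous_depth⟩ else .const _ 0)
    (fun s a ha => by split_ifs <;> simp [TopSimplex.depth_eq_zero ha])
  refine ⟨μ, hcont, fun s hs hA a => by rw [hcell s hs, if_pos hA]; rfl, fun x hx hμ => ?_⟩
  rcases mem_skel_succ_iff.1 hx with hx | ⟨s, hs, a, rfl⟩
  · exact absurd hμ (hskel x hx).not_gt
  · refine ⟨s, hs, ?_, a, rfl⟩
    by_contra hA
    rw [hcell s hs, if_neg hA] at hμ
    exact lt_irrefl _ hμ

variable {T : PathProperty (SSet.toTop.obj X)}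

lemma holdsFor_of_collar (hT : T.TransClosed)
    (hs : ∀ (k : ℕ) (s : X _⦋k⦌) (q : C(I, TopSimplex k)), T.HoldsFor ((charMap s).comp q))
    (hskel : ∀ g : C(I, SSet.toTop.obj X), (∀ t, g t ∈ skel X n) → T.HoldsFor g)
    {f : C(I, SSet.toTop.obj X)} (hf : ∀ t, f t ∈ skel X (n + 1))
    (hdepth : ∀ t, ∀ s ∈ X.nonDegenerate n, ∀ a, charMap s a = f t → TopSimplex.depth a < 1 / 2) :
    T.HoldsFor f := by
  obtain ⟨Φ, hΦ, hexpand⟩ := TopSimplex.exists_expand n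
  obtain ⟨h, hh⟩ := exists_isCellDeformation X (TopSimplex.lineHomotopy Φ hΦ)
  let g : C(I, SSet.toTop.obj X) := ⟨fun t => h (f t) 1,
    (continuous_eval_const (1 : I)).comp (hh.continuousOn.comp_continuous f.continuous hf)⟩
  refine hh.holdsFor hT hs (g := g) hf (fun t => rfl) (hskel g fun t => ?_)
  change h (f t) 1 ∈ skel X n
  rcases mem_skel_succ_iff.1 (hf t) with hx | ⟨s, hs, a, hsa⟩
  · rwa [hh.eq_of_mem_skel _ hx]
  · rw [← hsa, hh.eq_charMap s hs, ContinuousMap.HomotopyWith.apply_one]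
    exact charMap_mem_skel_of_not_isInterior s (hexpand a (hdepth t s hs a hsa))

lemma holdsFor_of_core (hT : T.TransClosed)
    (hs : ∀ (k : ℕ) (s : X _⦋k⦌) (q : C(I, TopSimplex k)), T.HoldsFor ((charMap s).comp q))
    {f : C(I, SSet.toTop.obj X)} {s : X _⦋n⦌} (hsn : s ∈ X.nonDegenerate n)
    (hdepth : ∀ t, ∃ a, charMap s a = f t ∧ 1 / 4 < TopSimplex.depth a) : T.HoldsFor f := by
  obtain ⟨Φ, b, hΦ, hcollapse⟩ := TopSimplex.exists_collapse n
  obtain ⟨h, hh⟩ := exists_isCellDeformation X (TopSimplex.lineHomotopy Φ hΦ)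
  refine hh.holdsFor hT hs (g := (charMap s).comp (.const I b)) (fun t => ?_) (fun t => ?_)
    (hs n s _)
  all_goals obtain ⟨a, hsa, ha⟩ := hdepth t; rw [← hsa]
  · exact mem_skel_succ_iff.2 (.inr ⟨s, hsn, a, rfl⟩)
  · rw [hh.eq_charMap s hsn, ContinuousMap.HomotopyWith.apply_one, hcollapse a ha]
    rfl

theorem holdsFor_of_forall_mem_skel (hT : T.TransClosed)
    (hs : ∀ (k : ℕ) (s : X _⦋k⦌) (q : C(I, TopSimplex k)), T.HoldsFor ((charMap s).comp q))
    (f : C(I, SSet.toTop.obj X)) (hf : ∀ t, f t ∈ skel X n) : T.HoldsFor f := by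
  induction n generalizing f with
  | zero =>
    obtain ⟨k, s, a, hk, -⟩ := hf 0
    exact absurd hk k.not_lt_zero
  | succ n ih =>
    obtain ⟨μ, hμ, hμdepth, hμcell⟩ := exists_depth (X := X) n Set.univ
    choose ν hν hνdepth hνcell using fun s : X _⦋n⦌ => exists_depth n {s}
    -- A collar of the lower skeleton, and the core of each cell.
    let c : Option (X.nonDegenerate n) → Set I := fun o =>
      o.elim {t | μ (f t) < 1 / 2} fun s => {t | 1 / 4 < ν s (f t)}
    have hc : ∀ o, IsOpen (c o) := by
      rintro (_ | s)
      · exact isOpen_lt (hμ.comp_continuous f.continuous hf) continuous_const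
      · exact isOpen_lt continuous_const ((hν s).comp_continuous f.continuous hf)
    have hcov : Set.univ ⊆ ⋃ o, c o := by
      intro t _
      rw [Set.mem_iUnion]
      by_cases ht : μ (f t) < 1 / 2
      · exact ⟨none, ht⟩
      obtain ⟨s, hsn, -, a, ha⟩ := hμcell _ (hf t) (by linarith)
      refine ⟨some ⟨s, hsn⟩, ?_⟩
      change 1 / 4 < ν s (f t)
      rw [← ha, hνdepth s s hsn rfl, ← hμdepth s hsn (Set.mem_univ s), ha]
      linarith
    refine hT.holdsFor_of_cover f hc hcov fun o g hg => ?_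
    rcases o with _ | ⟨s, hsn⟩
    · refine holdsFor_of_collar hT hs ih (fun t => hf (g t)) fun t s hsn a ha => ?_
      rw [← hμdepth s hsn (Set.mem_univ s), ha]
      exact hg t
    · refine holdsFor_of_core hT hs hsn fun t => ?_
      have hνt : 1 / 4 < ν s (f (g t)) := hg t
      obtain ⟨_, -, rfl, a, ha⟩ := hνcell s _ (hf (g t)) (by linarith)
      exact ⟨a, ha, by rwa [← hνdepth _ _ hsn rfl, ha]⟩

theorem forall_of_simplices (hT : T.TransClosed)
    (hs : ∀ (k : ℕ) (s : X _⦋k⦌) (q : C(I, TopSimplex k)), T.HoldsFor ((charMap s).comp q))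
    {x y : SSet.toTop.obj X} (p : Path.Homotopic.Quotient x y) : T p := by
  induction p using Path.Homotopic.Quotient.ind with | mk p =>
  obtain ⟨n, hn⟩ := exists_subset_skel_of_isCompact (isCompact_range p.continuous)
  exact (holdsFor_coe_iff p).1 (holdsFor_of_forall_mem_skel hT hs _ fun t => hn ⟨t, rfl⟩)

end GeometricRealization

/-! ### Generation of paths by edges -/

namespace TopSimplex

variable {Y : Type*} [TopologicalSpace Y] {m n : ℕ}

instance : SimplyConnectedSpace (TopSimplex n) :=
  have : ContractibleSpace (TopSimplex n) :=
    (convex_stdSimplex ℝ (Fin (n + 1))).contractibleSpace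
      ⟨_, (stdSimplex.vertex (S := ℝ) (0 : Fin (n + 1))).2⟩
  inferInstance

/-- The image under `c` of the unique homotopy class of paths from `a` to `b` in the simplex. -/
noncomputable def pathClass (c : C(TopSimplex n, Y)) (a b : TopSimplex n) :
    Path.Homotopic.Quotient (c a) (c b) :=
  (Path.Homotopic.Quotient.mk (PathConnectedSpace.somePath a b)).map c

variable (c : C(TopSimplex n, Y))

lemma map_eq_pathClass {a b : TopSimplex n} (p : Path.Homotopic.Quotient a b) :
    p.map c = pathClass c a b := by
  rw [pathClass, Subsingleton.elim (Path.Homotopic.Quotient.mk _) p]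

lemma pathClass_comp (g : C(TopSimplex m, TopSimplex n)) (a b : TopSimplex m) :
    pathClass (c.comp g) a b = pathClass c (g a) (g b) := by
  rw [pathClass, Path.Homotopic.Quotient.map_comp, map_eq_pathClass]

lemma pathClass_trans (a b d : TopSimplex n) :
    (pathClass c a b).trans (pathClass c b d) = pathClass c a d := by
  rw [← map_eq_pathClass c (.mk ((PathConnectedSpace.somePath a b).trans
    (PathConnectedSpace.somePath b d)))]
  simp only [pathClass, ← Path.Homotopic.Quotient.mk_map, ← Path.Homotopic.Quotient.mk_trans,
    Path.map_trans]

lemma pathClass_self (a : TopSimplex n) : pathClass c a a = .refl (c a) :=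
  (map_eq_pathClass c (.refl a)).symm

lemma pathClass_symm (a b : TopSimplex n) : (pathClass c a b).symm = pathClass c b a :=
  map_eq_pathClass c (Path.Homotopic.Quotient.mk (PathConnectedSpace.somePath a b)).symm

end TopSimplex

lemma quotient_cast_trans {Y : Type*} [TopologicalSpace Y] {x y z x' y' z' : Y}
    (p : Path.Homotopic.Quotient x y) (q : Path.Homotopic.Quotient y z)
    (hx : x' = x) (hy : y' = y) (hz : z' = z) :
    (p.trans q).cast hx hz = (p.cast hx hy).trans (q.cast hy hz) := by
  subst hx hy hz
  simp only [Path.Homotopic.Quotient.cast_rfl_rfl]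

lemma PathProperty.holdsFor_comp_iff {Y : Type*} [TopologicalSpace Y] {T : PathProperty Y} {n : ℕ}
    (c : C(TopSimplex n, Y)) (q : C(I, TopSimplex n)) :
    T.HoldsFor (c.comp q) ↔ T (TopSimplex.pathClass c (q 0) (q 1)) := by
  rw [← TopSimplex.map_eq_pathClass c (.mk (⟨q, rfl, rfl⟩ : Path (q 0) (q 1)))]
  rfl

/-- A property of homotopy classes of paths is closed under path reversal. -/
def PathProperty.SymmClosed {Y : Type*} [TopologicalSpace Y] (T : PathProperty Y) : Prop :=
  ∀ ⦃x y : Y⦄ ⦃p : Path.Homotopic.Quotient x y⦄, T p → T p.symm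

namespace GeometricRealization

open SSet (realizationPoint Edge)

variable {X : SSet.{u}} {n : ℕ}

lemma realizationPoint_eq_charMap (x : X _⦋0⦌) :
    realizationPoint x = charMap x (stdSimplex.vertex 0) := by
  rw [realizationPoint, TopCat.toSSetObj₀Equiv_apply]
  exact congrArg _ (Subsingleton.elim _ _)

lemma realizationPoint_map (f : ⦋0⦌ ⟶ ⦋n⦌) (s : X _⦋n⦌) :
    realizationPoint (X.map f.op s) = charMap s (stdSimplex.vertex (f 0)) := by
  rw [realizationPoint_eq_charMap, charMap_map_apply, TopSimplex.map_vertex]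

lemma realizationPoint_injective : Function.Injective (realizationPoint (X := X)) := by
  intro x y h
  have hx (z : X _⦋0⦌) : z ∈ X.nonDegenerate 0 := by simp
  have hv : TopSimplex.IsInterior (n := 0) (stdSimplex.vertex 0) := by
    intro i
    simp [Fin.fin_one_eq_zero i]
  rw [realizationPoint_eq_charMap, realizationPoint_eq_charMap] at h
  simpa using normalForm_unique (hx x) (hx y) hv hv h

lemma stdSimplexHomeomorphUnitInterval_symm_zero :
    stdSimplexHomeomorphUnitInterval.symm 0 = stdSimplex.vertex (S := ℝ) 0 := by
  rw [Homeomorph.symm_apply_eq]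
  rfl

lemma stdSimplexHomeomorphUnitInterval_symm_one :
    stdSimplexHomeomorphUnitInterval.symm 1 = stdSimplex.vertex (S := ℝ) 1 := by
  rw [Homeomorph.symm_apply_eq]
  rfl

lemma mk_realizationPath {x y : X _⦋0⦌} (e : Edge x y) (f : ⦋1⦌ ⟶ ⦋n⦌) (s : X _⦋n⦌)
    (h : X.map f.op s = e.edge)
    (hx : realizationPoint x = charMap s (stdSimplex.vertex (f 0)))
    (hy : realizationPoint y = charMap s (stdSimplex.vertex (f 1))) :
    Path.Homotopic.Quotient.mk e.realizationPath =
      (TopSimplex.pathClass (charMap s) (stdSimplex.vertex (f 0))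
        (stdSimplex.vertex (f 1))).cast hx hy := by
  let q : Path (stdSimplex.vertex (S := ℝ) (f 0)) (stdSimplex.vertex (S := ℝ) (f 1)) :=
    { toFun := fun t => TopSimplex.map f (stdSimplexHomeomorphUnitInterval.symm t)
      continuous_toFun := (TopSimplex.map f).continuous.comp
        stdSimplexHomeomorphUnitInterval.symm.continuous
      source' := by rw [stdSimplexHomeomorphUnitInterval_symm_zero, TopSimplex.map_vertex]
      target' := by rw [stdSimplexHomeomorphUnitInterval_symm_one, TopSimplex.map_vertex] }
  rw [← TopSimplex.map_eq_pathClass _ (.mk q), ← Path.Homotopic.Quotient.mk_map,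
    ← Path.Homotopic.Quotient.mk_cast]
  congr 1
  ext t
  change charMap e.edge _ = charMap s (TopSimplex.map f _)
  rw [← h, charMap_map_apply]

lemma realizationPoint_source {x y : X _⦋0⦌} (e : Edge x y) (f : ⦋1⦌ ⟶ ⦋n⦌) (s : X _⦋n⦌)
    (h : X.map f.op s = e.edge) :
    realizationPoint x = charMap s (stdSimplex.vertex (f 0)) := by
  rw [← TopSimplex.map_vertex, ← charMap_map_apply, h]
  exact (congrArg realizationPoint e.src_eq).symm.trans
    (realizationPoint_map (SimplexCategory.δ 1) e.edge)

lemma realizationPoint_target {x y : X _⦋0⦌} (e : Edge x y) (f : ⦋1⦌ ⟶ ⦋n⦌) (s : X _⦋n⦌)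
    (h : X.map f.op s = e.edge) :
    realizationPoint y = charMap s (stdSimplex.vertex (f 1)) := by
  rw [← TopSimplex.map_vertex, ← charMap_map_apply, h]
  exact (congrArg realizationPoint e.tgt_eq).symm.trans
    (realizationPoint_map (SimplexCategory.δ 0) e.edge)

theorem mk_realizationPath_trans {x y z : X _⦋0⦌} {e₀₁ : Edge x y} {e₁₂ : Edge y z}
    {e₀₂ : Edge x z} (s : X _⦋2⦌) (h₂ : X.δ 2 s = e₀₁.edge) (h₀ : X.δ 0 s = e₁₂.edge)
    (h₁ : X.δ 1 s = e₀₂.edge) :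
    (Path.Homotopic.Quotient.mk e₀₁.realizationPath).trans (.mk e₁₂.realizationPath) =
      .mk e₀₂.realizationPath := by
  have hx := realizationPoint_source e₀₁ (SimplexCategory.δ 2) s h₂
  have hy := realizationPoint_target e₀₁ (SimplexCategory.δ 2) s h₂
  have hz := realizationPoint_target e₁₂ (SimplexCategory.δ 0) s h₀
  rw [mk_realizationPath e₀₁ (SimplexCategory.δ 2) s h₂ hx hy,
    mk_realizationPath e₁₂ (SimplexCategory.δ 0) s h₀ hy hz,
    mk_realizationPath e₀₂ (SimplexCategory.δ 1) s h₁ hx hz]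
  exact (quotient_cast_trans _ _ hx hy hz).symm.trans
    (congrArg (fun p => Path.Homotopic.Quotient.cast p hx hz) (TopSimplex.pathClass_trans _ _ _ _))

variable {T : PathProperty (SSet.toTop.obj X)}

lemma pathClass_vertex_of_edges (hsymm : T.SymmClosed)
    (he : ∀ ⦃x y : X _⦋0⦌⦄ (e : Edge x y), T (.mk e.realizationPath)) (s : X _⦋n⦌)
    (i j : Fin (n + 1)) :
    T (TopSimplex.pathClass (charMap s) (stdSimplex.vertex i) (stdSimplex.vertex j)) := by
  wlog hij : i ≤ j generalizing i j
  · rw [← TopSimplex.pathClass_symm]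
    exact hsymm (this j i (le_of_not_ge hij))
  let f := SimplexCategory.mkOfLe i j hij
  let e := Edge.mk' (X.map f.op s)
  have h := he e
  rwa [mk_realizationPath e f s rfl (realizationPoint_source e f s rfl)
    (realizationPoint_target e f s rfl), PathProperty.cast_iff (T := T)] at h

/-- The paths to `c a` that have the property `T` when continued, within the simplex, to its initial
vertex. -/
def coneSet (T : PathProperty (SSet.toTop.obj X)) (c : C(TopSimplex n, SSet.toTop.obj X))
    (a : TopSimplex n) : Set (Σ y y' : SSet.toTop.obj X, Path.Homotopic.Quotient y y') :=
  {p | ∃ h : c a = p.2.1, T ((p.2.2.cast rfl h).trans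
    (TopSimplex.pathClass c a (stdSimplex.vertex 0)))}

lemma mem_coneSet {c : C(TopSimplex n, SSet.toTop.obj X)} {a : TopSimplex n}
    {y : SSet.toTop.obj X} {γ : Path.Homotopic.Quotient y (c a)} :
    ⟨y, c a, γ⟩ ∈ coneSet T c a ↔ T (γ.trans (TopSimplex.pathClass c a (stdSimplex.vertex 0))) := by
  simp only [coneSet, Set.mem_ofPred_eq, exists_true_left, Path.Homotopic.Quotient.cast_rfl_rfl]

lemma coneSet_comp (hT : T.TransClosed) {m : ℕ} {c : C(TopSimplex n, SSet.toTop.obj X)}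
    {g : C(TopSimplex m, TopSimplex n)}
    (h₁ : T (TopSimplex.pathClass c (g (stdSimplex.vertex 0)) (stdSimplex.vertex 0)))
    (h₂ : T (TopSimplex.pathClass c (stdSimplex.vertex 0) (g (stdSimplex.vertex 0))))
    (a : TopSimplex m) : coneSet T (c.comp g) a = coneSet T c (g a) := by
  ext ⟨y, y', γ⟩
  refine exists_congr fun h => ?_
  change c (g a) = y' at h
  subst h
  rw [TopSimplex.pathClass_comp]
  constructor <;> intro h
  · simpa only [Path.Homotopic.Quotient.trans_assoc, TopSimplex.pathClass_trans] using hT h h₁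
  · simpa only [Path.Homotopic.Quotient.trans_assoc, TopSimplex.pathClass_trans] using hT h h₂

/-- Join every point to the initial vertex of a simplex that contains it. -/
theorem forall_of_edges (hT : T.TransClosed) (hsymm : T.SymmClosed)
    (he : ∀ ⦃x y : X _⦋0⦌⦄ (e : Edge x y), T (.mk e.realizationPath))
    {x y : X _⦋0⦌} (p : Path.Homotopic.Quotient (realizationPoint x) (realizationPoint y)) :
    T p := by
  have hvert {k : ℕ} (s : X _⦋k⦌) := pathClass_vertex_of_edges hsymm he s
  obtain ⟨F, hF⟩ := exists_desc_fun (X := X) (fun _ s a => coneSet T (charMap s) a)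
    (fun _ _ f s a => by
      rw [charMap_map]
      refine coneSet_comp hT ?_ ?_ a <;> rw [TopSimplex.map_vertex] <;> exact hvert _ _ _)
  let T' : PathProperty (SSet.toTop.obj X) := fun y y' q =>
    ∀ (z : SSet.toTop.obj X) (γ : Path.Homotopic.Quotient z y),
      ⟨z, y, γ⟩ ∈ F y → ⟨z, y', γ.trans q⟩ ∈ F y'
  have hT' : T'.TransClosed := fun x y z p q hp hq w γ hγ => by
    rw [← Path.Homotopic.Quotient.trans_assoc]
    exact hq _ _ (hp _ γ hγ)
  have hs (k : ℕ) (s : X _⦋k⦌) (q : C(I, TopSimplex k)) : T'.HoldsFor ((charMap s).comp q) := by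
    rw [PathProperty.holdsFor_comp_iff]
    intro z γ hγ
    rw [hF, mem_coneSet] at hγ ⊢
    rwa [Path.Homotopic.Quotient.trans_assoc, TopSimplex.pathClass_trans]
  have hx := realizationPoint_eq_charMap x
  have hy := realizationPoint_eq_charMap y
  have h := forall_of_simplices hT' hs (p.cast hx.symm hy.symm) _ (.refl _) (by
    rw [hF, mem_coneSet, Path.Homotopic.Quotient.refl_trans]
    exact hvert x 0 0)
  rwa [hF, mem_coneSet, TopSimplex.pathClass_self, Path.Homotopic.Quotient.trans_refl,
    Path.Homotopic.Quotient.refl_trans, PathProperty.cast_iff (T := T)] at h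

end GeometricRealization

/-! ### Step functions and cocycles -/

section

open MeasureTheory

attribute [local instance] Measure.Subtype.measureSpace

/-- Functions from the half-open unit interval to `G`, with the topology of convergence in measure
for the discrete metric on `G`. The group `G` acts freely and properly discontinuously on them, so
that the orbit space is the base of a covering with deck group `G`. -/
def StepFun (G : Type u) : Type u := Set.Ico (0 : ℝ) 1 → G

namespace StepFun

variable {G : Type u}

/-- The constant step function. -/
def const (g : G) : StepFun G := fun _ => g

instance : IsProbabilityMeasure (volume : Measure (Set.Ico (0 : ℝ) 1)) :=
  ⟨by simp [Measure.Subtype.volume_univ measurableSet_Ico.nullMeasurableSet]⟩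

noncomputable instance : PseudoMetricSpace (StepFun G) where
  dist f g := (volume : Measure (Set.Ico (0 : ℝ) 1)).real {t | f t ≠ g t}
  dist_self f := by simp
  dist_comm f g := by simp only [ne_comm]
  dist_triangle f g h := by
    refine (measureReal_mono fun t ht => ?_).trans (measureReal_union_le _ _)
    by_cases hfg : f t = g t
    · exact Or.inr fun hgh => ht (hfg.trans hgh)
    · exact Or.inl hfg

lemma dist_def (f g : StepFun G) :
    dist f g = (volume : Measure (Set.Ico (0 : ℝ) 1)).real {t | f t ≠ g t} := rfl

variable [Group G]

instance : MulAction G (StepFun G) where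
  smul g f := fun t => g * f t
  one_smul f := funext fun t => one_mul (f t)
  mul_smul g h f := funext fun t => mul_assoc g h (f t)

lemma smul_apply (g : G) (f : StepFun G) (t : Set.Ico (0 : ℝ) 1) : (g • f) t = g * f t := rfl

lemma dist_smul_smul (g : G) (f f' : StepFun G) : dist (g • f) (g • f') = dist f f' := by
  simp [dist_def, smul_apply]

lemma dist_smul_self {g : G} (hg : g ≠ 1) (f : StepFun G) : dist (g • f) f = 1 := by
  simp [dist_def, smul_apply, hg]

variable (G) in
/-- The orbit space of `StepFun G`. It receives the classifying maps of cocycles with values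
in `G`. -/
def OrbitSpace : Type u := Quotient (MulAction.orbitRel G (StepFun G))

instance : TopologicalSpace (OrbitSpace G) :=
  inferInstanceAs (TopologicalSpace (Quotient (MulAction.orbitRel G (StepFun G))))

/-- The projection of `StepFun G` to its orbit space. -/
def toOrbit (f : StepFun G) : OrbitSpace G := Quotient.mk'' f

lemma toOrbit_smul (g : G) (f : StepFun G) : toOrbit (g • f) = toOrbit f :=
  Quotient.eq''.2 ⟨g, rfl⟩

lemma isQuotientCoveringMap_toOrbit : IsQuotientCoveringMap (toOrbit (G := G)) G where
  toIsQuotientMap := isQuotientMap_quotient_mk'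
  continuous_const_smul g := (Isometry.of_dist_eq (dist_smul_smul g)).continuous
  apply_eq_iff_mem_orbit := Quotient.eq''
  disjoint f := by
    refine ⟨Metric.ball f (1 / 2), Metric.ball_mem_nhds f (by norm_num), fun g => ?_⟩
    rintro ⟨_, ⟨f', hf', rfl⟩, hgf'⟩
    by_contra hg
    have htriangle := dist_triangle_right (g • f') f' f
    rw [dist_smul_self hg] at htriangle
    have h₁ : dist f' f < 1 / 2 := hf'
    have h₂ : dist (g • f') f < 1 / 2 := hgf'
    linarith

end StepFun

namespace TopSimplex

variable {m n : ℕ}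

lemma lt_sum_Iic_last (a : TopSimplex n) (t : Set.Ico (0 : ℝ) 1) :
    (t : ℝ) < ∑ j ∈ Finset.Iic (Fin.last n), a j := by
  rw [show Finset.Iic (Fin.last n) = Finset.univ from Finset.Iic_top, stdSimplex.sum_eq_one]
  exact t.2.2

/-- The barycentric coordinates of `a` cut the half-open unit interval into consecutive half-open
intervals, and `index a t` is the number of the interval containing `t`. -/
noncomputable def index (a : TopSimplex n) (t : Set.Ico (0 : ℝ) 1) : Fin (n + 1) :=
  ({i | (t : ℝ) < ∑ j ∈ Finset.Iic i, a j} : Finset (Fin (n + 1))).min'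
    ⟨Fin.last n, by simpa using lt_sum_Iic_last a t⟩

lemma index_le_iff {a : TopSimplex n} {t : Set.Ico (0 : ℝ) 1} {i : Fin (n + 1)} :
    index a t ≤ i ↔ (t : ℝ) < ∑ j ∈ Finset.Iic i, a j := by
  refine ⟨fun h => ?_, fun h => Finset.min'_le _ _ (by simpa using h)⟩
  have hmem := Finset.min'_mem ({i | (t : ℝ) < ∑ j ∈ Finset.Iic i, a j} : Finset (Fin (n + 1)))
    ⟨Fin.last n, by simpa using lt_sum_Iic_last a t⟩
  exact (Finset.mem_filter.1 hmem).2.trans_le (Finset.sum_le_sum_of_subset_of_nonneg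
    (Finset.Iic_subset_Iic.2 h) fun j _ _ => stdSimplex.zero_le a j)

lemma index_mem_iff {a : TopSimplex n} {t : Set.Ico (0 : ℝ) 1} {S : Finset (Fin (n + 1))}
    (hS : IsLowerSet (S : Set (Fin (n + 1)))) : index a t ∈ S ↔ (t : ℝ) < ∑ j ∈ S, a j := by
  have hmono {S' S : Finset (Fin (n + 1))} (h : S' ⊆ S) : ∑ j ∈ S', a j ≤ ∑ j ∈ S, a j :=
    Finset.sum_le_sum_of_subset_of_nonneg h fun j _ _ => stdSimplex.zero_le a j
  refine ⟨fun h => ?_, fun h => ?_⟩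
  · exact (index_le_iff.1 le_rfl).trans_le (hmono fun j hj => hS (Finset.mem_Iic.1 hj) h)
  · have hne : S.Nonempty := by
      by_contra hempty
      rw [Finset.not_nonempty_iff_eq_empty.1 hempty, Finset.sum_empty] at h
      exact h.not_ge t.2.1
    have hmax : index a t ≤ S.max' hne := index_le_iff.2 <| h.trans_le <| hmono fun j hj =>
      Finset.mem_Iic.2 (S.le_max' j hj)
    exact hS hmax (S.max'_mem hne)

lemma index_map (f : ⦋m⦌ ⟶ ⦋n⦌) (a : TopSimplex m) (t : Set.Ico (0 : ℝ) 1) :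
    index (map f a) t = f (index a t) := by
  refine eq_of_forall_ge_iff fun k => ?_
  have hlower : IsLowerSet (({i | f i ≤ k} : Finset (Fin (m + 1))) : Set (Fin (m + 1))) :=
    fun i j hji hi => by
      simp only [Finset.coe_filter, Finset.mem_univ, true_and, Set.mem_ofPred_eq] at hi ⊢
      exact (f.toOrderHom.monotone hji).trans hi
  have hsum : ∑ j ∈ Finset.Iic k, map f a j = ∑ i with f i ≤ k, a i := by
    simp only [map_apply, Finset.sum_fiberwise_eq_sum_filter, Finset.mem_Iic]
  rw [index_le_iff, hsum, ← index_mem_iff hlower, Finset.mem_filter_univ]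

lemma index_vertex (i : Fin (n + 1)) (t : Set.Ico (0 : ℝ) 1) :
    index (stdSimplex.vertex i) t = i := by
  have h := index_map (⦋0⦌.const ⦋n⦌ i) (stdSimplex.vertex 0) t
  rwa [map_vertex] at h

variable {G : Type u}

/-- The step function whose `i`-th value is `p i`, attained on an interval of length `a i`. -/
noncomputable def step (p : Fin (n + 1) → G) (a : TopSimplex n) : StepFun G :=
  fun t => p (index a t)

lemma step_map (p : Fin (n + 1) → G) (f : ⦋m⦌ ⟶ ⦋n⦌) (a : TopSimplex m) :
    step p (map f a) = step (p ∘ f) a :=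
  funext fun t => congrArg p (index_map f a t)

lemma step_vertex (p : Fin (n + 1) → G) (i : Fin (n + 1)) :
    step p (stdSimplex.vertex i) = StepFun.const (p i) :=
  funext fun t => congrArg p (index_vertex i t)

lemma exists_mem_uIcc_of_index_ne {a b : TopSimplex n} {t : Set.Ico (0 : ℝ) 1}
    (h : index a t ≠ index b t) :
    ∃ k, (t : ℝ) ∈ Set.uIcc (∑ j ∈ Finset.Iic k, a j) (∑ j ∈ Finset.Iic k, b j) := by
  contrapose! h
  refine eq_of_forall_ge_iff fun k => ?_
  rw [index_le_iff, index_le_iff]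
  have hk := h k
  rw [Set.mem_uIcc, not_or, not_and, not_and] at hk
  exact ⟨fun hlt => lt_of_not_ge fun hle => hk.2 hle hlt.le,
    fun hlt => lt_of_not_ge fun hle => hk.1 hle hlt.le⟩

lemma dist_step_le (p : Fin (n + 1) → G) (a b : TopSimplex n) :
    dist (step p a) (step p b) ≤
      ∑ k, |∑ j ∈ Finset.Iic k, b j - ∑ j ∈ Finset.Iic k, a j| := by
  let U (k : Fin (n + 1)) : Set (Set.Ico (0 : ℝ) 1) :=
    (↑) ⁻¹' Set.uIcc (∑ j ∈ Finset.Iic k, a j) (∑ j ∈ Finset.Iic k, b j)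
  have hsub : {t | step p a t ≠ step p b t} ⊆ ⋃ k, U k := fun t ht =>
    Set.mem_iUnion.2 (exists_mem_uIcc_of_index_ne fun h => ht (congrArg p h))
  refine (measureReal_mono hsub).trans ((measureReal_iUnion_fintype_le _).trans ?_)
  refine Finset.sum_le_sum fun k _ => ENNReal.toReal_le_of_le_ofReal (abs_nonneg _) ?_
  rw [volume_preimage_coe measurableSet_Ico.nullMeasurableSet measurableSet_uIcc,
    ← Real.volume_interval]
  exact measure_mono Set.inter_subset_left

lemma continuous_step (p : Fin (n + 1) → G) : Continuous (step p) := by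
  refine continuous_iff_continuousAt.2 fun a => tendsto_iff_dist_tendsto_zero.2 ?_
  have hcont : Continuous fun b : TopSimplex n =>
      ∑ k, |∑ j ∈ Finset.Iic k, a j - ∑ j ∈ Finset.Iic k, b j| :=
    continuous_finsetSum _ fun k _ =>
      (continuous_const.sub (continuous_finsetSum _ fun j _ => continuous_coord j)).abs
  refine squeeze_zero (fun _ => dist_nonneg) (fun b => dist_step_le p b a) ?_
  simpa using hcont.tendsto a

end TopSimplex

end

/-- A 1-cocycle on `X` with values in `G`. Equivalently, a homomorphism from the edge-path groupoid
of `X` to `G`. -/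
structure OneCocycle (X : SSet.{u}) (G : Type u) [Group G] where
  toFun : X _⦋1⦌ → G
  map_δ_one : ∀ s : X _⦋2⦌, toFun (X.δ 1 s) = toFun (X.δ 2 s) * toFun (X.δ 0 s)

namespace OneCocycle

open SSet (realizationPoint Edge)

variable {X : SSet.{u}} {G : Type u} [Group G] (c : OneCocycle X G) {n : ℕ}

/-- The value of `c` on the edge of `s` from its initial vertex to its `i`-th vertex. -/
def primitive (s : X _⦋n⦌) (i : Fin (n + 1)) : G :=
  c.toFun (X.map (SimplexCategory.mkOfLe 0 i (Fin.zero_le i)).op s)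

lemma map_mkOfLe (s : X _⦋n⦌) {i j k : Fin (n + 1)} (hij : i ≤ j) (hjk : j ≤ k) :
    c.toFun (X.map (SimplexCategory.mkOfLe i k (hij.trans hjk)).op s) =
      c.toFun (X.map (SimplexCategory.mkOfLe i j hij).op s) *
        c.toFun (X.map (SimplexCategory.mkOfLe j k hjk).op s) := by
  have hδ (l : Fin 3) (f : ⦋1⦌ ⟶ ⦋n⦌)
      (hf : SimplexCategory.δ l ≫ SimplexCategory.mkOfLeComp i j k hij hjk = f) :
      X.δ l (X.map (SimplexCategory.mkOfLeComp i j k hij hjk).op s) = X.map f.op s :=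
    hf ▸ (GeometricRealization.map_comp_op_apply _ _ s).symm
  have h := c.map_δ_one (X.map (SimplexCategory.mkOfLeComp i j k hij hjk).op s)
  rwa [hδ 1 _ (SimplexCategory.Hom.ext_one_left _ (SimplexCategory.mkOfLe i k (hij.trans hjk))),
    hδ 2 _ (SimplexCategory.Hom.ext_one_left _ (SimplexCategory.mkOfLe i j hij)),
    hδ 0 _ (SimplexCategory.Hom.ext_one_left _ (SimplexCategory.mkOfLe j k hjk))] at h

lemma primitive_zero (s : X _⦋n⦌) : c.primitive s 0 = 1 := by
  simpa [primitive] using c.map_mkOfLe s (le_refl 0) (le_refl 0)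

lemma primitive_map {m : ℕ} (f : ⦋m⦌ ⟶ ⦋n⦌) (s : X _⦋n⦌) (i : Fin (m + 1)) :
    c.primitive s (f i) = c.primitive s (f 0) * c.primitive (X.map f.op s) i := by
  have hle : f 0 ≤ f i := f.toOrderHom.monotone (Fin.zero_le i)
  have hf : SimplexCategory.mkOfLe 0 i (Fin.zero_le i) ≫ f =
      SimplexCategory.mkOfLe (f 0) (f i) hle :=
    SimplexCategory.Hom.ext_one_left _ _
  rw [primitive, c.map_mkOfLe s (Fin.zero_le (f 0)) hle, primitive, primitive,
    ← GeometricRealization.map_comp_op_apply, hf]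

lemma primitive_one (e : X _⦋1⦌) : c.primitive e 1 = c.toFun e := by
  have hid : SimplexCategory.mkOfLe (n := 1) 0 1 (Fin.zero_le 1) = 𝟙 ⦋1⦌ :=
    SimplexCategory.Hom.ext_one_left _ _
  simp [primitive, hid]

theorem exists_classifyingMap : ∃ F : C(SSet.toTop.obj X, StepFun.OrbitSpace G),
    ∀ (n : ℕ) (s : X _⦋n⦌) (a : TopSimplex n),
      F (GeometricRealization.charMap s a) =
        StepFun.toOrbit (TopSimplex.step (c.primitive s) a) := by
  obtain ⟨F, hF⟩ := GeometricRealization.exists_desc (X := X) (Z := StepFun.OrbitSpace G)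
    (fun n s => ⟨fun a => StepFun.toOrbit (TopSimplex.step (c.primitive s) a),
      StepFun.isQuotientCoveringMap_toOrbit.continuous.comp (TopSimplex.continuous_step _)⟩)
    (fun m n f s => ContinuousMap.ext fun a => by
      have hstep : TopSimplex.step (c.primitive s) (TopSimplex.map f a) =
          c.primitive s (f 0) • TopSimplex.step (c.primitive (X.map f.op s)) a := by
        rw [TopSimplex.step_map]
        exact funext fun t => c.primitive_map f s _
      exact (StepFun.toOrbit_smul _ _).symm.trans (congrArg StepFun.toOrbit hstep.symm))
  exact ⟨F, fun n s a => DFunLike.congr_fun (hF n s) a⟩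

/-- The map that sends a simplex of `X` to the step functions with values given by a primitive
of `c` on that simplex. It is independent of the chosen primitive up to translation. -/
noncomputable def classifyingMap : C(SSet.toTop.obj X, StepFun.OrbitSpace G) :=
  c.exists_classifyingMap.choose

lemma classifyingMap_charMap (s : X _⦋n⦌) (a : TopSimplex n) :
    c.classifyingMap (GeometricRealization.charMap s a) =
      StepFun.toOrbit (TopSimplex.step (c.primitive s) a) :=
  c.exists_classifyingMap.choose_spec n s a

lemma toOrbit_const (g : G) (x : X _⦋0⦌) :
    StepFun.toOrbit (StepFun.const g) = c.classifyingMap (realizationPoint x) := by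
  have h := StepFun.toOrbit_smul g (TopSimplex.step (c.primitive x) (stdSimplex.vertex 0))
  rw [← classifyingMap_charMap, ← GeometricRealization.realizationPoint_eq_charMap,
    TopSimplex.step_vertex, primitive_zero] at h
  rw [← h]
  exact congrArg StepFun.toOrbit (funext fun _ => (mul_one g).symm)

/-- The constant step functions, as points of the fibre over a vertex. -/
def constLift (x : X _⦋0⦌) (g : G) :
    StepFun.toOrbit (G := G) ⁻¹' {c.classifyingMap (realizationPoint x)} :=
  ⟨StepFun.const g, c.toOrbit_const g x⟩

/-- The extension of `c` to homotopy classes of paths between vertices, as the monodromy of the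
covering pulled back along the classifying map. -/
noncomputable def holonomy {x y : X _⦋0⦌}
    (p : Path.Homotopic.Quotient (realizationPoint x) (realizationPoint y)) : G :=
  StepFun.isQuotientCoveringMap_toOrbit.fiberEquivGroup (c.constLift y 1)
    (StepFun.isQuotientCoveringMap_toOrbit.isCoveringMap.monodromy (p.map c.classifyingMap)
      (c.constLift x 1))

lemma toPermFiber_constLift (x : X _⦋0⦌) (g h : G) :
    StepFun.isQuotientCoveringMap_toOrbit.toPermFiber _ g (c.constLift x h) =
      c.constLift x (g * h) := rfl

lemma constLift_injective (x : X _⦋0⦌) : Function.Injective (c.constLift x) := fun _ _ h =>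
  congrFun (congrArg Subtype.val h) ⟨0, Set.left_mem_Ico.2 one_pos⟩

lemma monodromy_constLift {x y : X _⦋0⦌}
    (p : Path.Homotopic.Quotient (realizationPoint x) (realizationPoint y)) (g : G) :
    StepFun.isQuotientCoveringMap_toOrbit.isCoveringMap.monodromy (p.map c.classifyingMap)
      (c.constLift x g) = c.constLift y (g * c.holonomy p) := by
  have h₁ : StepFun.isQuotientCoveringMap_toOrbit.isCoveringMap.monodromy (p.map c.classifyingMap)
      (c.constLift x 1) = c.constLift y (c.holonomy p) := by
    rw [← mul_one (c.holonomy p), ← toPermFiber_constLift]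
    exact Subtype.ext
      (StepFun.isQuotientCoveringMap_toOrbit.fiberEquivGroup_smul_self (c.constLift y 1)).symm
  rw [← toPermFiber_constLift, ← h₁, ← StepFun.isQuotientCoveringMap_toOrbit.monodromy_toPermFiber,
    toPermFiber_constLift, mul_one]

lemma holonomy_trans {x y z : X _⦋0⦌}
    (p : Path.Homotopic.Quotient (realizationPoint x) (realizationPoint y))
    (q : Path.Homotopic.Quotient (realizationPoint y) (realizationPoint z)) :
    c.holonomy (p.trans q) = c.holonomy p * c.holonomy q := by
  have hmap : (p.trans q).map c.classifyingMap =
      (p.map c.classifyingMap).trans (q.map c.classifyingMap) := by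
    induction p using Path.Homotopic.Quotient.ind with | _ p
    induction q using Path.Homotopic.Quotient.ind with | _ q
    simp only [← Path.Homotopic.Quotient.mk_trans, ← Path.Homotopic.Quotient.mk_map, Path.map_trans]
  apply c.constLift_injective z
  rw [← one_mul (c.holonomy (p.trans q)), ← monodromy_constLift, hmap,
    IsCoveringMap.monodromy_trans_apply, monodromy_constLift, monodromy_constLift, one_mul]

lemma holonomy_symm {x y : X _⦋0⦌}
    (p : Path.Homotopic.Quotient (realizationPoint x) (realizationPoint y)) :
    c.holonomy p.symm = (c.holonomy p)⁻¹ := by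
  have hrefl := c.holonomy_trans (.refl (realizationPoint y)) (.refl (realizationPoint y))
  rw [Path.Homotopic.Quotient.refl_trans, right_eq_mul] at hrefl
  rw [eq_inv_iff_mul_eq_one, ← holonomy_trans, Path.Homotopic.Quotient.symm_trans, hrefl]

theorem holonomy_realizationPath {x y : X _⦋0⦌} (e : Edge x y) :
    c.holonomy (.mk e.realizationPath) = c.toFun e.edge := by
  let lift : Path (StepFun.const (1 : G)) (StepFun.const (c.toFun e.edge)) :=
    { toFun := fun t => TopSimplex.step (c.primitive e.edge)
        (stdSimplexHomeomorphUnitInterval.symm t)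
      continuous_toFun := (TopSimplex.continuous_step _).comp
        stdSimplexHomeomorphUnitInterval.symm.continuous
      source' := by
        rw [GeometricRealization.stdSimplexHomeomorphUnitInterval_symm_zero,
          TopSimplex.step_vertex, primitive_zero]
      target' := by
        rw [GeometricRealization.stdSimplexHomeomorphUnitInterval_symm_one,
          TopSimplex.step_vertex, primitive_one] }
  apply c.constLift_injective y
  rw [← one_mul (c.holonomy _), ← monodromy_constLift]
  refine StepFun.isQuotientCoveringMap_toOrbit.isCoveringMap.monodromy_eq_of_map_eq
    (ex := c.constLift x 1) (ey := c.constLift y (c.toFun e.edge)) (.mk lift) ?_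
  refine congrArg Path.Homotopic.Quotient.mk (Path.ext (funext fun t => ?_))
  exact (c.classifyingMap_charMap e.edge (stdSimplexHomeomorphUnitInterval.symm t)).symm

end OneCocycle

/-! ### Squares categories -/

namespace SimpleDoubleCategory

open SSet (realizationPoint Edge)

variable {C : SimpleDoubleCategory.{u}}

lemma mk₁_eq_square {F G : C.HFun (Fin 2)} (α : F ⟶ G) :
    (ComposableArrows.mk₁ α : C.diagNT _⦋1⦌) =
      square (HFun.Hom.dist α (homOfLE (Fin.zero_le 1))) := by
  obtain ⟨F⟩ := F
  obtain ⟨G⟩ := G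
  obtain ⟨A, B, f, rfl⟩ := ComposableArrows.mk₁_surjective F
  obtain ⟨A', B', f', rfl⟩ := ComposableArrows.mk₁_surjective G
  refine congrArg ComposableArrows.mk₁ (HFun.Hom.ext (funext fun i => ?_))
  match i with
  | 0 => rfl
  | 1 => rfl

lemma eq_square (s : ComposableArrows (C.HFun (Fin 2)) 1) :
    (s : C.diagNT _⦋1⦌) = square (HFun.Hom.dist (s.map (homOfLE (Fin.zero_le 1)))
      (homOfLE (Fin.zero_le (1 : Fin 2)))) :=
  (ComposableArrows.mk₁_hom s).symm.trans (mk₁_eq_square _)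

lemma squareEdge_induction {motive : ∀ ⦃x y : C.diagNT _⦋0⦌⦄, Edge x y → Prop}
    (hsquare : ∀ ⦃A B A' B' : C.Ob⦄ ⦃f : C.catM.Hom A B⦄ ⦃f' : C.catM.Hom A' B'⦄
      ⦃g : C.catE.Hom A A'⦄ ⦃g' : C.catE.Hom B B'⦄ (h : C.Dist f f' g g'), motive (squareEdge h))
    ⦃x y : C.diagNT _⦋0⦌⦄ (e : Edge x y) : motive e := by
  obtain ⟨A, B, A', B', f, f', g, g', h, he⟩ : ∃ (A B A' B' : C.Ob) (f : C.catM.Hom A B)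
      (f' : C.catM.Hom A' B') (g : C.catE.Hom A A') (g' : C.catE.Hom B B')
      (h : C.Dist f f' g g'), e.edge = square h := ⟨_, _, _, _, _, _, _, _, _, eq_square e.edge⟩
  obtain rfl : x = vertex A :=
    e.src_eq.symm.trans ((congrArg (C.diagNT.δ 1) he).trans (squareEdge h).src_eq)
  obtain rfl : y = vertex B' :=
    e.tgt_eq.symm.trans ((congrArg (C.diagNT.δ 0) he).trans (squareEdge h).tgt_eq)
  obtain rfl : e = squareEdge h := Edge.ext he
  exact hsquare h

/-- Two horizontally composable distinguished squares as a morphism of `T_2 C`. -/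
def squareHom₂ {A₀ A₁ A₂ B₀ B₁ B₂ : C.Ob} {f₁ : C.catM.Hom A₀ A₁} {f₂ : C.catM.Hom A₁ A₂}
    {k₁ : C.catM.Hom B₀ B₁} {k₂ : C.catM.Hom B₁ B₂} {g₀ : C.catE.Hom A₀ B₀}
    {g₁ : C.catE.Hom A₁ B₁} {g₂ : C.catE.Hom A₂ B₂}
    (h₁ : C.Dist f₁ k₁ g₀ g₁) (h₂ : C.Dist f₂ k₂ g₁ g₂) :
    (⟨ComposableArrows.mk₂ (C := C.M) f₁ f₂⟩ : C.HFun (Fin 3)) ⟶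
      ⟨ComposableArrows.mk₂ (C := C.M) k₁ k₂⟩ where
  app X := match X with
    | 0 => g₀
    | 1 => g₁
    | 2 => g₂
  dist := by
    intro X Y k
    match X, Y, k with
    | 0, 0, _ => exact C.dist_hid g₀
    | 0, 1, _ => exact h₁
    | 0, 2, _ => exact C.dist_hcomp h₁ h₂
    | 1, 1, _ => exact C.dist_hid g₁
    | 1, 2, _ => exact h₂
    | 2, 2, _ => exact C.dist_hid g₂
    | 1, 0, k => exact absurd (leOfHom k) (by decide)
    | 2, 0, k => exact absurd (leOfHom k) (by decide)
    | 2, 1, k => exact absurd (leOfHom k) (by decide)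

section Grid

variable {A₀ A₁ A₂ B₀ B₁ B₂ D₀ D₁ D₂ : C.Ob}
  {f₁ : C.catM.Hom A₀ A₁} {f₂ : C.catM.Hom A₁ A₂}
  {k₁ : C.catM.Hom B₀ B₁} {k₂ : C.catM.Hom B₁ B₂}
  {l₁ : C.catM.Hom D₀ D₁} {l₂ : C.catM.Hom D₁ D₂}
  {g₀ : C.catE.Hom A₀ B₀} {g₁ : C.catE.Hom A₁ B₁} {g₂ : C.catE.Hom A₂ B₂}
  {p₀ : C.catE.Hom B₀ D₀} {p₁ : C.catE.Hom B₁ D₁} {p₂ : C.catE.Hom B₂ D₂}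
  (h₁₁ : C.Dist f₁ k₁ g₀ g₁) (h₁₂ : C.Dist f₂ k₂ g₁ g₂)
  (h₂₁ : C.Dist k₁ l₁ p₀ p₁) (h₂₂ : C.Dist k₂ l₂ p₁ p₂)

/-- A two-by-two grid of distinguished squares as a 2-simplex of the diagonal. -/
def grid : C.diagNT _⦋2⦌ := ComposableArrows.mk₂ (squareHom₂ h₁₁ h₁₂) (squareHom₂ h₂₁ h₂₂)

lemma δ_two_grid : C.diagNT.δ 2 (grid h₁₁ h₁₂ h₂₁ h₂₂) = square h₁₁ :=
  eq_square (C.diagNT.δ 2 (grid h₁₁ h₁₂ h₂₁ h₂₂) : C.diagNT _⦋1⦌)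

lemma δ_zero_grid : C.diagNT.δ 0 (grid h₁₁ h₁₂ h₂₁ h₂₂) = square h₂₂ :=
  eq_square (C.diagNT.δ 0 (grid h₁₁ h₁₂ h₂₁ h₂₂) : C.diagNT _⦋1⦌)

lemma δ_one_grid : C.diagNT.δ 1 (grid h₁₁ h₁₂ h₂₁ h₂₂) =
    square (C.dist_vcomp (C.dist_hcomp h₁₁ h₁₂) (C.dist_hcomp h₂₁ h₂₂)) :=
  eq_square (C.diagNT.δ 1 (grid h₁₁ h₁₂ h₂₁ h₂₂) : C.diagNT _⦋1⦌)

end Grid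

/-- The point of the realization given by an object. -/
noncomputable abbrev point (A : C.Ob) : SSet.toTop.obj C.diagNT := realizationPoint (vertex A)

lemma point_injective : Function.Injective (point (C := C)) := fun _ _ h =>
  congrArg (fun x : ComposableArrows (C.HFun (Fin 1)) 0 => (x.obj 0).functor.obj 0)
    (GeometricRealization.realizationPoint_injective h)

/-- The homotopy class of the path given by a distinguished square. -/
noncomputable def squarePath {A B A' B' : C.Ob} {f : C.catM.Hom A B} {f' : C.catM.Hom A' B'}
    {g : C.catE.Hom A A'} {g' : C.catE.Hom B B'} (h : C.Dist f f' g g') :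
    Path.Homotopic.Quotient (point A) (point B') :=
  .mk (squareEdge h).realizationPath

/-- The homotopy class of the path given by a vertical morphism. -/
noncomputable abbrev vPath {A B : C.Ob} (g : C.catE.Hom A B) :
    Path.Homotopic.Quotient (point A) (point B) := squarePath (C.dist_hid g)

/-- The homotopy class of the path given by a horizontal morphism. -/
noncomputable abbrev hPath {A B : C.Ob} (f : C.catM.Hom A B) :
    Path.Homotopic.Quotient (point A) (point B) := squarePath (C.dist_vid f)

lemma squarePath_trans {A₀ A₁ A₂ B₀ B₁ B₂ D₀ D₁ D₂ : C.Ob}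
    {f₁ : C.catM.Hom A₀ A₁} {f₂ : C.catM.Hom A₁ A₂} {k₁ : C.catM.Hom B₀ B₁}
    {k₂ : C.catM.Hom B₁ B₂} {l₁ : C.catM.Hom D₀ D₁} {l₂ : C.catM.Hom D₁ D₂}
    {g₀ : C.catE.Hom A₀ B₀} {g₁ : C.catE.Hom A₁ B₁} {g₂ : C.catE.Hom A₂ B₂}
    {p₀ : C.catE.Hom B₀ D₀} {p₁ : C.catE.Hom B₁ D₁} {p₂ : C.catE.Hom B₂ D₂}
    (h₁₁ : C.Dist f₁ k₁ g₀ g₁) (h₁₂ : C.Dist f₂ k₂ g₁ g₂)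
    (h₂₁ : C.Dist k₁ l₁ p₀ p₁) (h₂₂ : C.Dist k₂ l₂ p₁ p₂)
    {f : C.catM.Hom A₀ A₂} {l : C.catM.Hom D₀ D₂} {g : C.catE.Hom A₀ D₀} {p : C.catE.Hom A₂ D₂}
    (h : C.Dist f l g p) (hf : C.catM.comp f₁ f₂ = f) (hl : C.catM.comp l₁ l₂ = l)
    (hg : C.catE.comp g₀ p₀ = g) (hp : C.catE.comp g₂ p₂ = p) :
    (squarePath h₁₁).trans (squarePath h₂₂) = squarePath h := by
  subst hf hl hg hp
  exact GeometricRealization.mk_realizationPath_trans (grid h₁₁ h₁₂ h₂₁ h₂₂)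
    (δ_two_grid _ _ _ _) (δ_zero_grid _ _ _ _) (δ_one_grid _ _ _ _)

lemma vPath_trans {A B D : C.Ob} (g : C.catE.Hom A B) (g' : C.catE.Hom B D) :
    (vPath g).trans (vPath g') = vPath (C.catE.comp g g') :=
  squarePath_trans (C.dist_hid g) (C.dist_hid g) (C.dist_hid g') (C.dist_hid g') _
    (C.catM.id_comp _) (C.catM.id_comp _) rfl rfl

lemma hPath_trans {A B D : C.Ob} (f : C.catM.Hom A B) (f' : C.catM.Hom B D) :
    (hPath f).trans (hPath f') = hPath (C.catM.comp f f') :=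
  squarePath_trans (C.dist_vid f) (C.dist_vid f') (C.dist_vid f) (C.dist_vid f') _
    rfl rfl (C.catE.id_comp _) (C.catE.id_comp _)

variable {A B A' B' : C.Ob} {f : C.catM.Hom A B} {f' : C.catM.Hom A' B'}
  {g : C.catE.Hom A A'} {g' : C.catE.Hom B B'} (h : C.Dist f f' g g')

lemma vPath_trans_hPath : (vPath g).trans (hPath f') = squarePath h :=
  squarePath_trans (C.dist_hid g) h (C.dist_vid _) (C.dist_vid f') h
    (C.catM.id_comp _) (C.catM.id_comp _) (C.catE.comp_id _) (C.catE.comp_id _)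

lemma hPath_trans_vPath : (hPath f).trans (vPath g') = squarePath h :=
  squarePath_trans (C.dist_vid f) (C.dist_vid _) h (C.dist_hid g') h
    (C.catM.comp_id _) (C.catM.comp_id _) (C.catE.id_comp _) (C.catE.id_comp _)

end SimpleDoubleCategory

namespace SquaresCategory

open SimpleDoubleCategory
open Path.Homotopic.Quotient (trans_assoc refl_trans trans_refl trans_symm symm_trans)

variable (C : SquaresCategory.{u})

/-- The homotopy class of `pathE`. -/
noncomputable def classE (A : C.Ob) : Path.Homotopic.Quotient (point C.O) (point A) :=
  .mk (C.pathE A)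

/-- The homotopy class of `pathM`. -/
noncomputable def classM (A : C.Ob) : Path.Homotopic.Quotient (point C.O) (point A) :=
  .mk (C.pathM A)

lemma objClass_eq (A : C.Ob) :
    C.objClass A = FundamentalGroup.fromPath ((C.classE A).trans (C.classM A).symm) := rfl

lemma vPath_eq_classE {A : C.Ob} (g : C.catE.Hom C.O A) : vPath g = C.classE A :=
  congrArg vPath (@Limits.IsInitial.hom_ext _ C.catE _ _ C.isInitialE _ _)

lemma hPath_eq_classM {A : C.Ob} (f : C.catM.Hom C.O A) : hPath f = C.classM A :=
  congrArg hPath (@Limits.IsInitial.hom_ext _ C.catM _ _ C.isInitialM _ _)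

lemma classE_trans {A B : C.Ob} (g : C.catE.Hom A B) :
    (C.classE A).trans (vPath g) = C.classE B :=
  (vPath_trans _ g).trans (C.vPath_eq_classE _)

lemma classM_trans {A B : C.Ob} (f : C.catM.Hom A B) :
    (C.classM A).trans (hPath f) = C.classM B :=
  (hPath_trans _ f).trans (C.hPath_eq_classM _)

lemma classE_O : C.classE C.O = .refl _ := by
  have h := C.classE_trans (C.catE.id C.O)
  rw [vPath_eq_classE] at h
  rw [← symm_trans (C.classE C.O)]
  nth_rw 3 [← h]
  rw [← trans_assoc, symm_trans, refl_trans]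

lemma classM_O : C.classM C.O = .refl _ := by
  rw [← classE_O, ← C.hPath_eq_classM (C.catM.id C.O), ← C.vPath_eq_classE (C.catE.id C.O)]

lemma objClass_O : C.objClass C.O = 1 := by
  rw [objClass_eq, classE_O, ← classM_O, trans_symm]
  rfl

/-- The loop at the basepoint obtained by closing a path up along vertical morphisms. -/
noncomputable def loopClass {A B : C.Ob} (p : Path.Homotopic.Quotient (point A) (point B)) : C.K₀ :=
  FundamentalGroup.fromPath (((C.classE A).trans p).trans (C.classE B).symm)

lemma loopClass_trans {A B D : C.Ob} (p : Path.Homotopic.Quotient (point A) (point B))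
    (q : Path.Homotopic.Quotient (point B) (point D)) :
    C.loopClass (p.trans q) = C.loopClass q * C.loopClass p := by
  have hcancel : (C.classE B).symm.trans ((C.classE B).trans (q.trans (C.classE D).symm)) =
      q.trans (C.classE D).symm := by
    rw [← trans_assoc, symm_trans, refl_trans]
  rw [FundamentalGroup.mul_def]
  change ((C.classE A).trans (p.trans q)).trans (C.classE D).symm =
    (((C.classE A).trans p).trans (C.classE B).symm).trans
      (((C.classE B).trans q).trans (C.classE D).symm)
  simp only [trans_assoc, hcancel]

lemma loopClass_refl (A : C.Ob) : C.loopClass (.refl (point A)) = 1 := by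
  have h : ((C.classE A).trans (.refl _)).trans (C.classE A).symm = .refl _ := by
    rw [trans_refl, trans_symm]
  exact congrArg FundamentalGroup.fromPath h

lemma loopClass_symm {A B : C.Ob} (p : Path.Homotopic.Quotient (point A) (point B)) :
    C.loopClass p.symm = (C.loopClass p)⁻¹ := by
  rw [eq_inv_iff_mul_eq_one, ← loopClass_trans, trans_symm, loopClass_refl]

lemma loopClass_fromPath (p : Path.Homotopic.Quotient (point C.O) (point C.O)) :
    C.loopClass p = FundamentalGroup.fromPath p := by
  have hrefl : (C.classE C.O).symm = .refl _ := by
    rw [← refl_trans (C.classE C.O).symm, ← classE_O, trans_symm, classE_O]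
  have h : ((C.classE C.O).trans p).trans (C.classE C.O).symm = p := by
    rw [hrefl, classE_O, refl_trans, trans_refl]
  exact congrArg FundamentalGroup.fromPath h

lemma loopClass_vPath {A B : C.Ob} (g : C.catE.Hom A B) : C.loopClass (vPath g) = 1 := by
  have h : ((C.classE A).trans (vPath g)).trans (C.classE B).symm = .refl _ := by
    rw [classE_trans, trans_symm]
  exact congrArg FundamentalGroup.fromPath h

lemma loopClass_classM (A : C.Ob) : C.loopClass (C.classM A) = (C.objClass A)⁻¹ := by
  have h : C.objClass A = C.loopClass ((C.classE A).trans (C.classM A).symm) := by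
    rw [loopClass_fromPath, objClass_eq]
  have hE : C.loopClass (C.classE A) = 1 := C.loopClass_vPath _
  rw [h, loopClass_trans, loopClass_symm, hE, mul_one, inv_inv]

lemma loopClass_hPath {A B : C.Ob} (f : C.catM.Hom A B) :
    C.loopClass (hPath f) = (C.objClass B)⁻¹ * C.objClass A := by
  rw [← loopClass_classM, ← classM_trans, loopClass_trans, loopClass_classM, inv_mul_cancel_right]

lemma loopClass_squarePath {A B A' B' : C.Ob} {f : C.catM.Hom A B} {f' : C.catM.Hom A' B'}
    {g : C.catE.Hom A A'} {g' : C.catE.Hom B B'} (h : C.Dist f f' g g') :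
    C.loopClass (squarePath h) = (C.objClass B')⁻¹ * C.objClass A' := by
  rw [← vPath_trans_hPath, loopClass_trans, loopClass_vPath, mul_one, loopClass_hPath]

lemma objClass_square {A B A' B' : C.Ob} (h : C.HasSquare A B A' B') :
    (C.objClass B')⁻¹ * C.objClass A' = (C.objClass B)⁻¹ * C.objClass A := by
  obtain ⟨f, f', g, g', h⟩ := h
  rw [← C.loopClass_squarePath h, ← hPath_trans_vPath h, loopClass_trans, loopClass_vPath, one_mul,
    loopClass_hPath]

/-- The paths between objects whose associated loop lies in `H`. -/
def HasLoopIn (H : Subgroup C.K₀) : PathProperty (SSet.toTop.obj C.diagNT) := fun x y p =>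
  ∃ (A B : C.Ob) (hA : point A = x) (hB : point B = y), C.loopClass (p.cast hA hB) ∈ H

variable {C}

lemma hasLoopIn_iff {H : Subgroup C.K₀} {A B : C.Ob}
    {p : Path.Homotopic.Quotient (point A) (point B)} :
    C.HasLoopIn H p ↔ C.loopClass p ∈ H := by
  refine ⟨fun ⟨A', B', hA, hB, h⟩ => ?_, fun h => ⟨A, B, rfl, rfl, ?_⟩⟩
  · obtain rfl := point_injective hA
    obtain rfl := point_injective hB
    rwa [Path.Homotopic.Quotient.cast_rfl_rfl] at h
  · rwa [Path.Homotopic.Quotient.cast_rfl_rfl]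

lemma hasLoopIn_transClosed (H : Subgroup C.K₀) : (C.HasLoopIn H).TransClosed := by
  rintro x y z p q ⟨A, B, rfl, rfl, hp⟩ ⟨B', D, hB', rfl, hq⟩
  obtain rfl := point_injective hB'
  rw [Path.Homotopic.Quotient.cast_rfl_rfl] at hp hq
  rw [hasLoopIn_iff, loopClass_trans]
  exact H.mul_mem hq hp

lemma hasLoopIn_symmClosed (H : Subgroup C.K₀) : (C.HasLoopIn H).SymmClosed := by
  rintro x y p ⟨A, B, rfl, rfl, hp⟩
  rw [Path.Homotopic.Quotient.cast_rfl_rfl] at hp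
  rw [hasLoopIn_iff, loopClass_symm]
  exact H.inv_mem hp

variable (C)

theorem closure_range_objClass : Subgroup.closure (Set.range C.objClass) = ⊤ := by
  refine (Subgroup.eq_top_iff' _).2 fun γ => ?_
  let H := Subgroup.closure (Set.range C.objClass)
  have hobj (A : C.Ob) : C.objClass A ∈ H := Subgroup.subset_closure ⟨A, rfl⟩
  have hall : C.HasLoopIn H (FundamentalGroup.toPath γ) :=
    GeometricRealization.forall_of_edges (hasLoopIn_transClosed H) (hasLoopIn_symmClosed H)
      (squareEdge_induction fun A B A' B' f f' g g' h => hasLoopIn_iff.2 <|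
        (C.loopClass_squarePath h).symm ▸ H.mul_mem (H.inv_mem (hobj B')) (hobj A')) _
  have hmem : C.loopClass (FundamentalGroup.toPath γ) ∈ H := hasLoopIn_iff.1 hall
  rwa [loopClass_fromPath] at hmem

/-- The class of an object in the group presented by objects and distinguished squares. -/
def presentedClass (A : C.Ob) : FreeAbelianGroup C.Ob ⧸ C.relations :=
  QuotientAddGroup.mk (FreeAbelianGroup.of A)

lemma presentedClass_O : C.presentedClass C.O = 0 :=
  (QuotientAddGroup.eq_zero_iff _).2 (AddSubgroup.subset_closure (Or.inl rfl))

lemma presentedClass_square {A B A' B' : C.Ob} (h : C.HasSquare A B A' B') :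
    C.presentedClass A + C.presentedClass B' = C.presentedClass B + C.presentedClass A' :=
  sub_eq_zero.1 <| (QuotientAddGroup.eq_zero_iff _).2 <|
    AddSubgroup.subset_closure (Or.inr ⟨A, B, A', B', h, rfl⟩)

variable {C} in
lemma presented_hom_ext {G : Type*} [AddCommGroup G]
    {φ ψ : FreeAbelianGroup C.Ob ⧸ C.relations →+ G}
    (h : ∀ A, φ (C.presentedClass A) = ψ (C.presentedClass A)) : φ = ψ :=
  QuotientAddGroup.addMonoidHom_ext _ (FreeAbelianGroup.lift_ext _ _ h)

/-- The cocycle sending a distinguished square to the difference of the classes of its upper left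
and upper right corners. It vanishes on vertical morphisms and is `-[A]` on `O → A` in `M`. -/
def squareCocycle : OneCocycle C.diagNT (Multiplicative (FreeAbelianGroup C.Ob ⧸ C.relations)) where
  toFun s :=
    let F : C.HFun (Fin 2) := (s : ComposableArrows (C.HFun (Fin 2)) 1).obj 0
    .ofAdd (C.presentedClass (F.functor.obj 0) - C.presentedClass (F.functor.obj 1))
  map_δ_one s := by
    let F : ComposableArrows (C.HFun (Fin 3)) 2 := s
    have h := C.presentedClass_square ⟨_, _, _, _, HFun.Hom.dist
      (F.map (homOfLE (Fin.zero_le 1))) (homOfLE (show (1 : Fin 3) ≤ 2 by decide))⟩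
    let c (i j : Fin 3) := C.presentedClass ((F.obj i).functor.obj j)
    change Multiplicative.ofAdd (c 0 0 - c 0 2) =
      Multiplicative.ofAdd ((c 0 0 - c 0 1) + (c 1 1 - c 1 2))
    change c 0 1 + c 1 2 = c 0 2 + c 1 1 at h
    rw [sub_add_sub_comm, h, add_sub_add_right_eq_sub]

lemma holonomy_squarePath {A B A' B' : C.Ob} {f : C.catM.Hom A B} {f' : C.catM.Hom A' B'}
    {g : C.catE.Hom A A'} {g' : C.catE.Hom B B'} (h : C.Dist f f' g g') :
    C.squareCocycle.holonomy (squarePath h) =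
      .ofAdd (C.presentedClass A - C.presentedClass B) :=
  C.squareCocycle.holonomy_realizationPath (squareEdge h)

/-- The homomorphism on `K_0` given by the holonomy of `squareCocycle`. -/
noncomputable def holonomyHom : C.K₀ →* Multiplicative (FreeAbelianGroup C.Ob ⧸ C.relations) :=
  MonoidHom.mk' (fun γ => C.squareCocycle.holonomy (FundamentalGroup.toPath γ)) fun x y =>
    (C.squareCocycle.holonomy_trans (FundamentalGroup.toPath y) (FundamentalGroup.toPath x)).trans
      (mul_comm _ _)

lemma holonomyHom_objClass (A : C.Ob) :
    C.holonomyHom (C.objClass A) = .ofAdd (C.presentedClass A) := by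
  have hE : C.squareCocycle.holonomy (C.classE A) =
      .ofAdd (C.presentedClass C.O - C.presentedClass C.O) := C.holonomy_squarePath _
  have hM : C.squareCocycle.holonomy (C.classM A) =
      .ofAdd (C.presentedClass C.O - C.presentedClass A) := C.holonomy_squarePath _
  change C.squareCocycle.holonomy ((C.classE A).trans (C.classM A).symm) = _
  rw [OneCocycle.holonomy_trans, OneCocycle.holonomy_symm, hE, hM, presentedClass_O, sub_self,
    zero_sub, ofAdd_zero, one_mul, ofAdd_neg, inv_inv]

lemma abelianization_objClass_square {A B A' B' : C.Ob} (h : C.HasSquare A B A' B') :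
    Abelianization.of (C.objClass A) * Abelianization.of (C.objClass B') =
      Abelianization.of (C.objClass B) * Abelianization.of (C.objClass A') := by
  have hsq := congrArg Abelianization.of (C.objClass_square h)
  simp only [map_mul, map_inv] at hsq
  rw [inv_mul_eq_div, inv_mul_eq_div, div_eq_div_iff_mul_eq_mul] at hsq
  rw [← hsq, mul_comm]

/-- The homomorphism sending `[A]` to the class of `objClass A`. -/
noncomputable def presentedHom :
    FreeAbelianGroup C.Ob ⧸ C.relations →+ Additive (Abelianization C.K₀) :=
  QuotientAddGroup.lift C.relations
    (FreeAbelianGroup.lift fun A => .ofMul (Abelianization.of (C.objClass A))) <| by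
    rw [relations, AddSubgroup.closure_le]
    rintro _ (rfl | ⟨A, B, A', B', h, rfl⟩)
    · exact (FreeAbelianGroup.lift_apply_of _ _).trans <|
        congrArg (Additive.ofMul ∘ Abelianization.of) C.objClass_O
    · simp only [SetLike.mem_coe, AddMonoidHom.mem_ker, map_sub, map_add,
        FreeAbelianGroup.lift_apply_of, ← ofMul_mul, sub_eq_zero]
      exact congrArg Additive.ofMul (C.abelianization_objClass_square h)

lemma presentedHom_presentedClass (A : C.Ob) :
    C.presentedHom (C.presentedClass A) = .ofMul (Abelianization.of (C.objClass A)) :=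
  FreeAbelianGroup.lift_apply_of _ _

lemma commute_objClass {A B X : C.Ob} (h : C.HasSquare C.O A B X) (h' : C.HasSquare C.O B A X) :
    Commute (C.objClass A) (C.objClass B) := by
  have hAB := C.objClass_square h
  have hBA := C.objClass_square h'
  rw [objClass_O, mul_one, inv_mul_eq_iff_eq_mul, eq_mul_inv_iff_mul_eq] at hAB hBA
  exact hBA.trans hAB.symm

/-- The group `K_0`, which is generated by the classes of objects, as a commutative group. -/
noncomputable abbrev commGroupK₀
    (hC : ∀ A B : C.Ob, ∃ X : C.Ob, C.HasSquare C.O A B X ∧ C.HasSquare C.O B A X) :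
    CommGroup C.K₀ where
  mul_comm x y := by
    have h : IsMulCommutative (Subgroup.closure (Set.range C.objClass)) :=
      Subgroup.isMulCommutative_closure <| by
        rintro _ ⟨A, rfl⟩ _ ⟨B, rfl⟩
        obtain ⟨X, hAB, hBA⟩ := hC A B
        exact C.commute_objClass hAB hBA
    rw [closure_range_objClass] at h
    exact setLike_mul_comm (Subgroup.mem_top x) (Subgroup.mem_top y)

end SquaresCategory

end

theorem mainTheorem1_general (C : SquaresCategory.{u}) :
    ∃ φ : (FreeAbelianGroup C.Ob ⧸ C.relations) ≃+ Additive (Abelianization C.K₀),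
      ∀ A : C.Ob, φ (QuotientAddGroup.mk (FreeAbelianGroup.of A)) =
        Additive.ofMul (Abelianization.of (C.objClass A)) := by
  let ψ := (Abelianization.lift C.holonomyHom).toAdditiveLeft
  have hψ (A : C.Ob) : ψ (.ofMul (.of (C.objClass A))) = C.presentedClass A :=
    C.holonomyHom_objClass A
  have hψφ : ψ.comp C.presentedHom = .id _ := SquaresCategory.presented_hom_ext fun A => by
    rw [AddMonoidHom.comp_apply, C.presentedHom_presentedClass, hψ, AddMonoidHom.id_apply]
  have hφψ : C.presentedHom.comp ψ = .id _ := by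
    refine MonoidHom.toAdditive.symm.injective (Abelianization.hom_ext _ _ ?_)
    refine MonoidHom.eq_of_eqOn_dense C.closure_range_objClass ?_
    rintro _ ⟨A, rfl⟩
    exact (congrArg C.presentedHom (hψ A)).trans (C.presentedHom_presentedClass A)
  exact ⟨C.presentedHom.toAddEquiv ψ hψφ hφψ, C.presentedHom_presentedClass⟩

theorem mainTheorem1 (C : SquaresCategory.{u})
    (hC : ∀ A B : C.Ob, ∃ X : C.Ob, C.HasSquare C.O A B X ∧ C.HasSquare C.O B A X) :
    ∃ φ : (FreeAbelianGroup C.Ob ⧸ C.relations) ≃+ Additive C.K₀,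
      ∀ A : C.Ob, φ (QuotientAddGroup.mk (FreeAbelianGroup.of A)) =
        Additive.ofMul (C.objClass A) := by
  let := C.commGroupK₀ hC
  obtain ⟨φ, hφ⟩ := mainTheorem1_general C
  exact ⟨φ.trans (MulEquiv.toAdditive Abelianization.equivOfComm.symm), fun A =>
    congrArg (MulEquiv.toAdditive Abelianization.equivOfComm.symm) (hφ A)⟩
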